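/- \textbf{Setting.} Let $m \ge 2$, $n \in \mathbb N$, $p \in (0,1]$, $\theta^* \in \mathbb R^n$ and $\beta^* \in \mathbb R^m$. Let $A_{li}$ and $X_{li}$ ($l \in [n]$, $i \in [m]$) be mutually independent $\{0,1\}$-valued random variables with $\Pr(A_{li}=1)=p$ and $\Pr(X_{li}=1)=1/(1+e^{-(\theta^*_l-\beta^*_i)})$ (the Rasch model with uniform sampling). Put $$\kappa=\max_{i,j}|\beta^*_i-\beta^*_j|,\quad \gamma=\min_{l}\min_{i\ne j}\mathbb E[X_{li}(1-X_{lj})],\quad B_{ij}=\sum_{l=1}^n A_{li}A_{lj},\quad d=\tfrac32\,m\,np^2 .$$ The empirical chain $M$ and the true chain $M^*$ are the $m\times m$ matrices with row sums $1$ whose off-diagonal entries are $$M_{ij}=\frac1d\sum_{l=1}^n A_{li}A_{lj}X_{li}(1-X_{lj}),\qquad M^*_{ij}=\frac1d\sum_{l=1}^n A_{li}A_{lj}\,\mathbb E[X_{li}(1-X_{lj})]\qquad(i\ne j),$$ and $\pi^*_i=e^{\beta^*_i}/\sum_k e^{\beta^*_k}$. Write $a\vee b=\max(a,b)$, $a\wedge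 b=\min(a,b)$. Let $\mathcal A$ be the event that $\frac{np^2}{2}\le B_{ij}\le\frac{3np^2}{2}$ for all $i\ne j$, and, for a constant $C_1$, let $\mathcal E$ be the event that $$|M_{ij}-M^*_{ij}|\le \frac{C_1\sqrt{\log np^2\vee\log m}}{\sqrt\gamma\,\sqrt{np^2}}\,M^*_{ij}\qquad\text{for all } i\neq j .$$ \textbf{Theorem.} For every constant $C_1\ge\sqrt{240}$ there are constants $C_2,C_3>0$, depending on $C_1$ only (so absolute for $C_1=\sqrt{240}$), such that in every setting as above with $$np^2>\frac{C_1^2}{\gamma}\left(\log np^2\vee\log m\right)\ \vee\ \frac{e^{4\kappa}C_2}{\gamma^3}\left(\log np^2\vee\log m\right)$$ the following holds with conditional probability, given $\mathcal A\cap\mathcal E$, at least $1-\left(e^{-40m}\wedge(np^2)^{-40}\right)$: $\pi^*$ is the unique stationary distribution of $M^*$, $M$ has a unique stationary distribution $\pi$, and $$\lVert\pi-\pi^*\rVert_\infty\le\frac{1}{\frac{\gamma}{3}\left(1-\frac{\gamma}{12e^{2\kappa}}\right)}\left(\frac{2C_1}{\sqrt\gamma}\,\frac{\sqrt{\log np^2\vee\log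 m}}{\sqrt{np^2}}+\frac{1+\frac{\gamma}{12e^{2\kappa}}}{\frac{\gamma}{6e^{2\kappa}}}\,\frac{C_3\sqrt{\frac{\log np^2}{m}\vee1}}{\sqrt{np^2}}\right)\lVert\pi^*\rVert_\infty .$$ -/

import Mathlib

open MeasureTheory ProbabilityTheory
open scoped Matrix

noncomputable section

namespace Rasch

/-- The numerical value of a bit: `1` for `true` and `0` for `false`. -/
def bit (b : Bool) : ℝ := if b then 1 else 0

/-- The Rasch model with `n` users of abilities `θ` and `m` items of difficulties `β` under uniform
sampling with probability `p`: `A l i` says whether the response of user `l` to item `i` is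
observed, `X l i` is that response, `P(A l i = 1) = p`,
`P(X l i = 1) = 1 / (1 + exp (-(θ l - β i)))`, and all these variables are mutually independent. -/
structure IsModel {Ω : Type*} [MeasurableSpace Ω] (μ : Measure Ω) {n m : ℕ} (p : ℝ)
    (θ : Fin n → ℝ) (β : Fin m → ℝ) (A X : Fin n → Fin m → Ω → Bool) : Prop where
  measurable_A : ∀ l i, Measurable (A l i)
  measurable_X : ∀ l i, Measurable (X l i)
  prob_A : ∀ l i, μ.real {ω | A l i ω = true} = p
  prob_X : ∀ l i, μ.real {ω | X l i ω = true} = 1 / (1 + Real.exp (-(θ l - β i)))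
  indep : iIndepFun (Sum.elim (fun q : Fin n × Fin m => A q.1 q.2)
    (fun q : Fin n × Fin m => X q.1 q.2)) μ

/-- The effective sample size `n p ^ 2`. -/
def np2 (n : ℕ) (p : ℝ) : ℝ := (n : ℝ) * p ^ 2

/-- `log (n p ^ 2) ∨ log m`. -/
def logMax (n m : ℕ) (p : ℝ) : ℝ := max (Real.log (np2 n p)) (Real.log m)

/-- The dynamic range `κ = max_{i, j} |β i - β j|` of the item parameters. -/
def kappa {m : ℕ} (β : Fin m → ℝ) : ℝ := ⨆ q : Fin m × Fin m, |β q.1 - β q.2|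

section Chain

variable {Ω : Type*} {n m : ℕ}

/-- `E[X l i (1 - X l j)]`. -/
def pairMean [MeasurableSpace Ω] (μ : Measure Ω) (X : Fin n → Fin m → Ω → Bool)
    (l : Fin n) (i j : Fin m) : ℝ :=
  ∫ ω, bit (X l i ω) * (1 - bit (X l j ω)) ∂μ

/-- `γ = min_l min_{i ≠ j} E[X l i (1 - X l j)]`. -/
def gamma [MeasurableSpace Ω] (μ : Measure Ω) (X : Fin n → Fin m → Ω → Bool) : ℝ :=
  ⨅ q : {q : Fin n × Fin m × Fin m // q.2.1 ≠ q.2.2}, pairMean μ X q.1.1 q.1.2.1 q.1.2.2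

/-- `B i j = ∑ l, A l i A l j`: the number of users whose responses to both items are observed. -/
def coCount (A : Fin n → Fin m → Ω → Bool) (i j : Fin m) (ω : Ω) : ℝ :=
  ∑ l, bit (A l i ω) * bit (A l j ω)

/-- The matrix with off-diagonal entries `w i j` whose diagonal entries are chosen so that every
row sums to `1`. -/
def chainOf (w : Fin m → Fin m → ℝ) : Matrix (Fin m) (Fin m) ℝ :=
  Matrix.of fun i j => if i = j then 1 - ∑ k ∈ Finset.univ.erase i, w i k else w i j

/-- The normalization `d = 3 m n p ^ 2 / 2`. -/
def normd (n m : ℕ) (p : ℝ) : ℝ := 3 * (m : ℝ) * np2 n p / 2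

/-- The empirical chain: `M i j = (1 / d) ∑ l, A l i A l j X l i (1 - X l j)` for `i ≠ j`. -/
def empChain (p : ℝ) (A X : Fin n → Fin m → Ω → Bool) (ω : Ω) : Matrix (Fin m) (Fin m) ℝ :=
  chainOf fun i j => 1 / normd n m p *
    ∑ l, bit (A l i ω) * bit (A l j ω) * (bit (X l i ω) * (1 - bit (X l j ω)))

/-- The true chain: `M* i j = (1 / d) ∑ l, A l i A l j E[X l i (1 - X l j)]` for `i ≠ j`; it depends
on the sample point through the sampling pattern `A` only. -/
def trueChain [MeasurableSpace Ω] (μ : Measure Ω) (p : ℝ) (A X : Fin n → Fin m → Ω → Bool)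
    (ω : Ω) : Matrix (Fin m) (Fin m) ℝ :=
  chainOf fun i j => 1 / normd n m p *
    ∑ l, bit (A l i ω) * bit (A l j ω) * pairMean μ X l i j

/-- Condition `𝒜`: `n p ^ 2 / 2 ≤ B i j ≤ 3 n p ^ 2 / 2` for all `i ≠ j`. -/
def condA (p : ℝ) (A : Fin n → Fin m → Ω → Bool) : Set Ω :=
  {ω | ∀ i j : Fin m, i ≠ j →
    np2 n p / 2 ≤ coCount A i j ω ∧ coCount A i j ω ≤ 3 * np2 n p / 2}

/-- Event `ℰ`: the off-diagonal entries of the empirical chain are close to those of the true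
chain. -/
def eventE [MeasurableSpace Ω] (μ : Measure Ω) (p : ℝ) (A X : Fin n → Fin m → Ω → Bool)
    (C₁ : ℝ) : Set Ω :=
  {ω | ∀ i j : Fin m, i ≠ j →
    |empChain p A X ω i j - trueChain μ p A X ω i j| ≤
      C₁ * √(logMax n m p) / (√(gamma μ X) * √(np2 n p)) * trueChain μ p A X ω i j}

end Chain

/-- `π` is a probability vector with `πᵀ M = πᵀ`. -/
def IsStationary {m : ℕ} (M : Matrix (Fin m) (Fin m) ℝ) (π : Fin m → ℝ) : Prop :=
  (∀ i, 0 ≤ π i) ∧ ∑ i, π i = 1 ∧ π ᵥ* M = π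

/-- `π` is the unique stationary distribution of `M`. -/
def IsTheStationary {m : ℕ} (M : Matrix (Fin m) (Fin m) ℝ) (π : Fin m → ℝ) : Prop :=
  IsStationary M π ∧ ∀ π', IsStationary M π' → π' = π

/-- `π* i = exp (β i) / ∑ k, exp (β k)`. -/
def piStar {m : ℕ} (β : Fin m → ℝ) (i : Fin m) : ℝ := Real.exp (β i) / ∑ k, Real.exp (β k)

/-- The factor in front of `‖π*‖` in the entrywise error bound. -/
def errFactor (n m : ℕ) (p γ κ C₁ C₃ : ℝ) : ℝ :=
  1 / (γ / 3 * (1 - γ / (12 * Real.exp (2 * κ)))) *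
    (2 * C₁ / √γ * (√(logMax n m p) / √(np2 n p)) +
      (1 + γ / (12 * Real.exp (2 * κ))) / (γ / (6 * Real.exp (2 * κ))) *
        (C₃ * √(max (Real.log (np2 n p) / m) 1) / √(np2 n p)))

end Rasch

end

/-! Write `ρ` for `π*`, `N` for `n p ^ 2`, `g` for `γ`, `ε` for the relative error in the event `ℰ`,
and `K` for the sup norm of `ρ`. In the Rasch model the ability of a user cancels from the ratio of
the probabilities of the two discordant answers to a pair of items. Hence `ρ` is reversible for
`M*`, whatever the sampling pattern.

On the good events every entry of `M` is at least `g / (6 m)`, and every off-diagonal entry is at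
most `1 / m`. By Doeblin's argument `M` contracts zero-sum vectors in `ℓ¹` by the factor `1 - g /
6`. This gives uniqueness and `‖π - ρ‖₁ ≤ (6 / g) ‖ρ M - ρ‖₁`. The passage to single entries uses
the balance equation at a state `i`: the inflow error is at most `‖π - ρ‖₁ / m`, because column
entries are at most `1 / m`, and what remains is a relative error of order `ε ρ i`
(`IsStationary.abs_sub_le`).

It remains to bound `‖ρ M - ρ‖₁`. For a fixed pattern `A` this is the maximum over `2 ^ m` sign
vectors of functions of the responses that are centred, as `ρ` is stationary for the mean chain, and
have bounded differences. McDiarmid's inequality and a union bound give order `K m √R / √N` with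
failure probability `2 ^ m exp (-88 m R)`, where `R = max (log N / m) 1`
(`bernProb_sum_abs_vecMul_sub`). The factor `m` cancels the `1 / m` above.

Finally, Chernoff bounds give the conditioning event probability at least `1 / 2`, so conditioning
costs a factor `2`, absorbed by the gap between the exponents `88` and `40`. All probabilities are
computed as finite sums over arrays of bits (`IsModel.real_eq`). -/

namespace Rasch

/-! ### Stationary distributions and their perturbation -/

section Markov

variable {m : ℕ}

/-- Doeblin's contraction: against a zero-sum vector the constant `c` can be subtracted from every
entry of `M`, leaving a nonnegative matrix with row sums `1 - m c`. -/
theorem sum_abs_vecMul_le {M : Matrix (Fin m) (Fin m) ℝ} {c : ℝ} (hc : ∀ i j, c ≤ M i j)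
    (hrow : ∀ i, ∑ j, M i j = 1) {v : Fin m → ℝ} (hv : ∑ i, v i = 0) :
    ∑ i, |(v ᵥ* M) i| ≤ (1 - m * c) * ∑ i, |v i| := by
  have h1 : ∀ i, |(v ᵥ* M) i| ≤ ∑ j, |v j| * (M j i - c) := by
    intro i
    have : (v ᵥ* M) i = ∑ j, v j * (M j i - c) := by
      simp only [Matrix.vecMul, dotProduct, mul_sub, Finset.sum_sub_distrib, ← Finset.sum_mul, hv]
      ring
    rw [this]
    refine (Finset.abs_sum_le_sum_abs _ _).trans (Finset.sum_le_sum fun j _ => ?_)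
    rw [abs_mul, abs_of_nonneg (sub_nonneg.2 (hc j i))]
  refine (Finset.sum_le_sum fun i _ => h1 i).trans ?_
  rw [Finset.sum_comm, Finset.mul_sum]
  refine Finset.sum_le_sum fun j _ => ?_
  rw [← Finset.mul_sum, Finset.sum_sub_distrib, hrow]
  simp [mul_comm]

theorem IsStationary.eq_of_le {M : Matrix (Fin m) (Fin m) ℝ} {c : ℝ} (hc0 : 0 < m * c)
    (hc : ∀ i j, c ≤ M i j) (hrow : ∀ i, ∑ j, M i j = 1) {π π' : Fin m → ℝ}
    (h : IsStationary M π) (h' : IsStationary M π') : π' = π := by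
  have hs : ∑ i, (π' - π) i = 0 := by simp [h.2.1, h'.2.1]
  have hle := sum_abs_vecMul_le hc hrow hs
  rw [Matrix.sub_vecMul, h.2.2, h'.2.2] at hle
  have hnn : 0 ≤ ∑ i, |(π' - π) i| := Finset.sum_nonneg fun i _ => abs_nonneg _
  have h0 : ∑ i, |(π' - π) i| = 0 := by nlinarith
  funext i
  have := (Finset.sum_eq_zero_iff_of_nonneg fun i _ => abs_nonneg _).1 h0 i (Finset.mem_univ i)
  simpa [sub_eq_zero] using this

/-- Constants lie in the right kernel of `1 - M`, so there is also a left fixed vector `v`. Then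
`|v| ≤ |v| M` entrywise while both sides have the same sum, so `|v|` is fixed and can be normalized.
-/
theorem exists_isStationary {M : Matrix (Fin m) (Fin m) ℝ} (hm : 0 < m)
    (hM : ∀ i j, 0 ≤ M i j) (hrow : ∀ i, ∑ j, M i j = 1) : ∃ π, IsStationary M π := by
  have hdet : (1 - M).det = 0 := by
    refine Matrix.exists_mulVec_eq_zero_iff.1 ⟨fun _ => 1, ?_, ?_⟩
    · intro h
      exact one_ne_zero (congrFun h ⟨0, hm⟩)
    · funext i
      simp [Matrix.mulVec, dotProduct, hrow, Matrix.one_apply]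
  obtain ⟨v, hv0, hv⟩ := Matrix.exists_vecMul_eq_zero_iff.2 hdet
  have hfix : v ᵥ* M = v := by
    rw [Matrix.vecMul_sub, Matrix.vecMul_one, sub_eq_zero] at hv
    exact hv.symm
  have hle : ∀ i, |v i| ≤ ((fun j => |v j|) ᵥ* M) i := by
    intro i
    conv_lhs => rw [← hfix]
    simp only [Matrix.vecMul, dotProduct]
    refine (Finset.abs_sum_le_sum_abs _ _).trans (Finset.sum_le_sum fun j _ => ?_)
    rw [abs_mul, abs_of_nonneg (hM j i)]
  have hsum : ∑ i, |v i| = ∑ i, ((fun j => |v j|) ᵥ* M) i := by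
    simp only [Matrix.vecMul, dotProduct]
    rw [Finset.sum_comm]
    simp [← Finset.mul_sum, hrow]
  have heq : ((fun j => |v j|) ᵥ* M) = fun j => |v j| := by
    funext i
    exact ((Finset.sum_eq_sum_iff_of_le fun i _ => hle i).1 hsum i (Finset.mem_univ i)).symm
  have hpos : 0 < ∑ i, |v i| := by
    obtain ⟨i, hi⟩ := Function.ne_iff.1 hv0
    exact Finset.sum_pos' (fun i _ => abs_nonneg _) ⟨i, Finset.mem_univ i, abs_pos.2 hi⟩
  refine ⟨(∑ i, |v i|)⁻¹ • fun j => |v j|, fun i => ?_, ?_, ?_⟩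
  · simp only [Pi.smul_apply, smul_eq_mul]
    positivity
  · simp only [Pi.smul_apply, smul_eq_mul, ← Finset.mul_sum]
    exact inv_mul_cancel₀ hpos.ne'
  · rw [Matrix.smul_vecMul, heq]

/-- Split `π - ρ = (π - ρ) M + (ρ M - ρ)` and absorb the first term by the contraction. -/
theorem IsStationary.sum_abs_sub_le {M : Matrix (Fin m) (Fin m) ℝ} {c t : ℝ} (hc0 : 0 < m * c)
    (hc : ∀ i j, c ≤ M i j) (hrow : ∀ i, ∑ j, M i j = 1) {π ρ : Fin m → ℝ}
    (h : IsStationary M π) (hρ : ∑ i, ρ i = 1) (ht : ∑ i, |(ρ ᵥ* M) i - ρ i| ≤ t) :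
    ∑ i, |π i - ρ i| ≤ t / (m * c) := by
  have hs : ∑ i, (π - ρ) i = 0 := by simp [h.2.1, hρ]
  have hle := sum_abs_vecMul_le hc hrow hs
  have htri : ∑ i, |(π - ρ) i| ≤
      ∑ i, |((π - ρ) ᵥ* M) i| + ∑ i, |(ρ ᵥ* M) i - ρ i| := by
    rw [← Finset.sum_add_distrib]
    refine Finset.sum_le_sum fun i _ => ?_
    have : (π - ρ) i = ((π - ρ) ᵥ* M) i + ((ρ ᵥ* M) i - ρ i) := by
      rw [Matrix.sub_vecMul, h.2.2]
      simp
    calc |(π - ρ) i| = |((π - ρ) ᵥ* M) i + ((ρ ᵥ* M) i - ρ i)| := by rw [← this]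
      _ ≤ _ := abs_add_le _ _
  rw [le_div_iff₀ hc0]
  simp only [Pi.sub_apply] at *
  nlinarith

theorem IsStationary.balance {M : Matrix (Fin m) (Fin m) ℝ} (hrow : ∀ i, ∑ j, M i j = 1)
    {π : Fin m → ℝ} (h : IsStationary M π) (i : Fin m) :
    ∑ j ∈ Finset.univ.erase i, π j * M j i = π i * ∑ j ∈ Finset.univ.erase i, M i j := by
  have h1 := congrFun h.2.2 i
  simp only [Matrix.vecMul, dotProduct] at h1
  rw [← Finset.add_sum_erase _ _ (Finset.mem_univ i)] at h1
  have h2 := hrow i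
  rw [← Finset.add_sum_erase _ _ (Finset.mem_univ i)] at h2
  have h3 : ∑ j ∈ Finset.univ.erase i, M i j = 1 - M i i := by linarith
  rw [h3]
  linarith

/-- Entrywise perturbation bound for stationary distributions under a relative entrywise
perturbation of the off-diagonal transition probabilities. -/
theorem IsStationary.abs_sub_le {M N : Matrix (Fin m) (Fin m) ℝ} {g ε t : ℝ} (hm : 2 ≤ m)
    (hg : 0 < g) (hg1 : g ≤ 1) (hε : ε ≤ 1 / 2)
    (hM : ∀ i, ∑ j, M i j = 1) (hN : ∀ i, ∑ j, N i j = 1)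
    (hMN : ∀ i j, i ≠ j → |M i j - N i j| ≤ ε * N i j)
    (hNg : ∀ i j, i ≠ j → g / (3 * m) ≤ N i j)
    (hMm : ∀ i j, i ≠ j → M i j ≤ 1 / m) (hMd : ∀ i, 1 / m ≤ M i i)
    {π ρ : Fin m → ℝ} (h : IsStationary M π) (hρ : IsStationary N ρ)
    (ht : ∑ i, |(ρ ᵥ* M) i - ρ i| ≤ t) (i : Fin m) :
    |π i - ρ i| ≤ 4 * ε * ρ i + 72 * t / (g ^ 2 * m) := by
  have hm0 : (2 : ℝ) ≤ m := by exact_mod_cast hm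
  have hlow : ∀ i j, i ≠ j → N i j / 2 ≤ M i j := by
    intro i j hij
    have h1 := abs_le.1 (hMN i j hij)
    have h2 : 0 ≤ N i j := le_trans (by positivity) (hNg i j hij)
    nlinarith
  have hc : ∀ i j, g / (6 * m) ≤ M i j := by
    intro i j
    by_cases hij : i = j
    · subst hij
      refine le_trans ?_ (hMd i)
      rw [div_le_div_iff₀ (by positivity) (by positivity)]
      nlinarith
    · have := hlow i j hij
      have h2 := hNg i j hij
      have : g / (6 * m) = g / (3 * m) / 2 := by field_simp; ring
      linarith
  have hmc : (m : ℝ) * (g / (6 * m)) = g / 6 := by field_simp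
  have hl1 := h.sum_abs_sub_le (by rw [hmc]; positivity) hc hM hρ.2.1 ht
  rw [hmc] at hl1
  set S := Finset.univ.erase i with hS
  have hSne : ∀ j ∈ S, j ≠ i := fun j hj => (Finset.mem_erase.1 hj).1
  set a := ∑ j ∈ S, M i j with ha
  set b := ∑ j ∈ S, N i j with hb
  -- `a` and `b` are the rates of leaving `i` under `M` and `N`; bounding `b` by `a` lets the
  -- relative errors survive the final division by `a`.
  have hba : b ≤ 2 * a := by
    rw [ha, hb, Finset.mul_sum]
    exact Finset.sum_le_sum fun j hj => by linarith [hlow i j (hSne j hj).symm]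
  have hcard : ((S.card : ℕ) : ℝ) = m - 1 := by
    rw [hS, Finset.card_erase_of_mem (Finset.mem_univ i), Finset.card_univ, Fintype.card_fin,
      Nat.cast_sub (by omega)]
    simp
  have hag : g / 12 ≤ a := by
    have : (S.card : ℝ) * (g / (6 * m)) ≤ a := by
      rw [ha, ← nsmul_eq_mul]
      exact Finset.card_nsmul_le_sum _ _ _ fun j _ => hc i j
    refine le_trans ?_ this
    rw [hcard, ← mul_div_assoc, div_le_div_iff₀ (by norm_num) (by positivity)]
    nlinarith
  have hb1 := h.balance hM i
  have hb2 := hρ.balance hN i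
  -- The difference of the two balance equations at `i`.
  have key : a * (π i - ρ i) = ∑ j ∈ S, (π j - ρ j) * M j i +
      (∑ j ∈ S, ρ j * (M j i - N j i) + ρ i * ∑ j ∈ S, (N i j - M i j)) := by
    simp only [sub_mul, mul_sub, Finset.sum_sub_distrib]
    rw [← hS] at hb1 hb2
    rw [hb1, hb2]
    ring
  have e1 : |∑ j ∈ S, (π j - ρ j) * M j i| ≤ 1 / m * (t / (g / 6)) := by
    calc |∑ j ∈ S, (π j - ρ j) * M j i| ≤ ∑ j ∈ S, |(π j - ρ j) * M j i| :=
          Finset.abs_sum_le_sum_abs _ _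
      _ ≤ ∑ j ∈ S, 1 / m * |π j - ρ j| := by
          refine Finset.sum_le_sum fun j hj => ?_
          have h0 : 0 ≤ M j i := le_trans (by positivity) (hc j i)
          rw [abs_mul, abs_of_nonneg h0, mul_comm]
          exact mul_le_mul_of_nonneg_right (hMm j i (hSne j hj)) (abs_nonneg _)
      _ ≤ ∑ j, 1 / m * |π j - ρ j| :=
          Finset.sum_le_univ_sum_of_nonneg fun j => by positivity
      _ ≤ _ := by
          rw [← Finset.mul_sum]
          gcongr
  -- Balance for `ρ` turns the inflow `∑ ρ j * N j i` into `ρ i * b`, so the error stays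
  -- proportional to `ρ i`.
  have e2 : |∑ j ∈ S, ρ j * (M j i - N j i)| ≤ ε * (ρ i * b) := by
    rw [hb, ← hρ.balance hN i, ← hS, Finset.mul_sum]
    refine (Finset.abs_sum_le_sum_abs _ _).trans (Finset.sum_le_sum fun j hj => ?_)
    rw [abs_mul, abs_of_nonneg (hρ.1 j)]
    nlinarith [hMN j i (hSne j hj), hρ.1 j]
  have e3 : |ρ i * ∑ j ∈ S, (N i j - M i j)| ≤ ε * (ρ i * b) := by
    rw [abs_mul, abs_of_nonneg (hρ.1 i), hb]
    have : |∑ j ∈ S, (N i j - M i j)| ≤ ε * ∑ j ∈ S, N i j := by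
      rw [Finset.mul_sum]
      refine (Finset.abs_sum_le_sum_abs _ _).trans (Finset.sum_le_sum fun j hj => ?_)
      rw [abs_sub_comm]
      exact hMN i j (hSne j hj).symm
    nlinarith [hρ.1 i]
  -- As `m ≥ 2` there is a pair with `N i j > 0`, and the relative bound for it forces `ε ≥ 0`.
  have hε0 : 0 ≤ ε := by
    obtain ⟨j, hj⟩ : S.Nonempty := by
      rw [← Finset.card_pos]
      have : (0 : ℝ) < S.card := by rw [hcard]; linarith
      exact_mod_cast this
    have hN0 : 0 < N i j := lt_of_lt_of_le (by positivity) (hNg i j (hSne j hj).symm)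
    nlinarith [(abs_nonneg _).trans (hMN i j (hSne j hj).symm)]
  have ha0 : 0 < a := lt_of_lt_of_le (by positivity) hag
  have ht0 : 0 ≤ t := (Finset.sum_nonneg fun i _ => abs_nonneg _).trans ht
  have e4 : a * |π i - ρ i| ≤ a * (4 * ε * ρ i + 72 * t / (g ^ 2 * m)) := by
    calc a * |π i - ρ i| = |a * (π i - ρ i)| := by rw [abs_mul, abs_of_pos ha0]
      _ ≤ 1 / m * (t / (g / 6)) + (ε * (ρ i * b) + ε * (ρ i * b)) := by
          rw [key]
          exact (abs_add_le _ _).trans (add_le_add e1 ((abs_add_le _ _).trans (add_le_add e2 e3)))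
      _ ≤ a * (72 * t / (g ^ 2 * m)) + 4 * a * ε * ρ i := by
          refine add_le_add ?_ ?_
          · calc 1 / m * (t / (g / 6)) = g / 12 * (72 * t / (g ^ 2 * m)) := by
                  field_simp; ring
              _ ≤ _ := by gcongr
          · have : ε * ρ i * b ≤ ε * ρ i * (2 * a) :=
              mul_le_mul_of_nonneg_left hba (mul_nonneg hε0 (hρ.1 i))
            linarith
      _ = _ := by ring
  exact le_of_mul_le_mul_left e4 ha0

end Markov

/-! ### Concentration for independent bits -/

section FiniteProduct

/-- The weight of a bit under the Bernoulli law with parameter `q`. -/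
def bernWeight (q : ℝ) (b : Bool) : ℝ := if b then q else 1 - q

variable {ι : Type*} [Fintype ι] [DecidableEq ι]

/-- The expectation of `F` when the coordinates of `x` are independent Bernoulli variables with
parameters `q i`. -/
def bernExp (q : ι → ℝ) (F : (ι → Bool) → ℝ) : ℝ :=
  ∑ x, (∏ i, bernWeight (q i) (x i)) * F x

/-- The probability of `S` when the coordinates are independent Bernoulli variables with
parameters `q i`. -/
noncomputable def bernProb (q : ι → ℝ) (S : Set (ι → Bool)) : ℝ :=
  bernExp q (S.indicator 1)

theorem bernWeight_nonneg {q : ℝ} (h : q ∈ Set.Icc (0 : ℝ) 1) (b : Bool) :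
    0 ≤ bernWeight q b := by
  unfold bernWeight
  split_ifs <;> linarith [h.1, h.2]

theorem bernExp_prod (q : ι → ℝ) (f : ι → Bool → ℝ) :
    bernExp q (fun x => ∏ i, f i (x i)) =
      ∏ i, (q i * f i true + (1 - q i) * f i false) := by
  have h := Finset.prod_univ_sum (fun _ : ι => (Finset.univ : Finset Bool))
    (fun i b => bernWeight (q i) b * f i b)
  rw [Fintype.piFinset_univ] at h
  simp only [bernExp, ← Finset.prod_mul_distrib]
  rw [← h]
  simp [bernWeight]

theorem bernExp_const (q : ι → ℝ) (c : ℝ) : bernExp q (fun _ => c) = c := by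
  have h := bernExp_prod q (fun _ _ => 1)
  simp only [bernExp, Finset.prod_const_one, mul_one, ← Finset.sum_mul] at h ⊢
  simp [h]

theorem bernExp_add (q : ι → ℝ) (F G : (ι → Bool) → ℝ) :
    bernExp q (fun x => F x + G x) = bernExp q F + bernExp q G := by
  simp [bernExp, mul_add, Finset.sum_add_distrib]

theorem bernExp_mul_left (q : ι → ℝ) (c : ℝ) (F : (ι → Bool) → ℝ) :
    bernExp q (fun x => c * F x) = c * bernExp q F := by
  simp only [bernExp, Finset.mul_sum]
  exact Finset.sum_congr rfl fun x _ => by ring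

theorem bernExp_sum {κ : Type*} (s : Finset κ) (q : ι → ℝ) (F : κ → (ι → Bool) → ℝ) :
    bernExp q (fun x => ∑ k ∈ s, F k x) = ∑ k ∈ s, bernExp q (F k) := by
  simp only [bernExp, Finset.mul_sum]
  exact Finset.sum_comm

theorem bernExp_mono {q : ι → ℝ} (hq : ∀ i, q i ∈ Set.Icc (0 : ℝ) 1) {F G : (ι → Bool) → ℝ}
    (h : ∀ x, F x ≤ G x) : bernExp q F ≤ bernExp q G :=
  Finset.sum_le_sum fun x _ => mul_le_mul_of_nonneg_left (h x)
    (Finset.prod_nonneg fun i _ => bernWeight_nonneg (hq i) _)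

theorem bernExp_nonneg {q : ι → ℝ} (hq : ∀ i, q i ∈ Set.Icc (0 : ℝ) 1) {F : (ι → Bool) → ℝ}
    (h : ∀ x, 0 ≤ F x) : 0 ≤ bernExp q F := by
  have := bernExp_mono hq h
  rwa [bernExp_const q 0] at this

theorem bernExp_pair (q : ι → ℝ) {i j : ι} (hij : i ≠ j) (f g : Bool → ℝ) :
    bernExp q (fun x => f (x i) * g (x j)) =
      (q i * f true + (1 - q i) * f false) * (q j * g true + (1 - q j) * g false) := by
  have h := bernExp_prod q (fun k => if k = i then f else if k = j then g else fun _ => 1)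
  rw [Finset.prod_eq_mul (s := Finset.univ) i j hij
    (fun k _ hk => by simp [hk.1, hk.2]) (by simp) (by simp)] at h
  simp only [if_true, if_neg hij.symm] at h
  rw [← h]
  congr 1
  funext x
  rw [Finset.prod_eq_mul i j hij (fun k _ hk => by simp [hk.1, hk.2]) (by simp) (by simp)]
  simp [hij.symm]

theorem bernExp_comp_equiv {κ : Type*} [Fintype κ] [DecidableEq κ] (e : κ ≃ ι) (q : ι → ℝ)
    (F : (ι → Bool) → ℝ) :
    bernExp q F = bernExp (fun k => q (e k)) (fun x => F (fun i => x (e.symm i))) := by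
  unfold bernExp
  refine Fintype.sum_equiv (Equiv.arrowCongr e.symm (Equiv.refl Bool)) _ _ fun x => ?_
  congr 1
  · rw [← e.prod_comp]
    simp
  · congr 1
    funext i
    simp

/-- The exponential Markov inequality: `exp (F x)` dominates the indicator of `S`. -/
theorem bernProb_le_of_exp {q : ι → ℝ} (hq : ∀ i, q i ∈ Set.Icc (0 : ℝ) 1)
    {S : Set (ι → Bool)} {F : (ι → Bool) → ℝ} (h : ∀ x ∈ S, 0 ≤ F x) :
    bernProb q S ≤ bernExp q (fun x => Real.exp (F x)) := by
  refine bernExp_mono hq fun x => ?_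
  by_cases hx : x ∈ S
  · simpa [hx] using h x hx
  · simpa [hx] using (Real.exp_pos _).le

theorem bernProb_mono {q : ι → ℝ} (hq : ∀ i, q i ∈ Set.Icc (0 : ℝ) 1)
    {S T : Set (ι → Bool)} (h : S ⊆ T) : bernProb q S ≤ bernProb q T :=
  bernExp_mono hq fun x => Set.indicator_le_indicator_of_subset h (fun _ => zero_le_one) x

theorem bernProb_iUnion_le {q : ι → ℝ} (hq : ∀ i, q i ∈ Set.Icc (0 : ℝ) 1) {κ : Type*}
    (s : Finset κ) (S : κ → Set (ι → Bool)) :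
    bernProb q (⋃ k ∈ s, S k) ≤ ∑ k ∈ s, bernProb q (S k) := by
  unfold bernProb
  rw [← bernExp_sum]
  refine bernExp_mono hq fun x => ?_
  by_cases hx : x ∈ ⋃ k ∈ s, S k
  · rw [Set.indicator_of_mem hx]
    simp only [Set.mem_iUnion] at hx
    obtain ⟨k, hk, hxk⟩ := hx
    refine le_trans ?_ (Finset.single_le_sum
      (fun k _ => Set.indicator_nonneg (fun _ _ => zero_le_one) x) hk)
    rw [Set.indicator_of_mem hxk, Pi.one_apply]
  · rw [Set.indicator_of_notMem hx]
    exact Finset.sum_nonneg fun k _ => Set.indicator_nonneg (fun _ _ => zero_le_one) x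

/-- Hoeffding's lemma for two points, with a constant that is not sharp. Symmetrize: by Jensen, `exp
(-mean)` is at most the mean of `exp (-·)`; the product of the two exponential moments is at most
`cosh (u - v)`, hence at most `exp ((u - v) ^ 2 / 2)`. -/
theorem two_point_exp_le {q : ℝ} (hq : q ∈ Set.Icc (0 : ℝ) 1) (u v : ℝ) :
    q * Real.exp u + (1 - q) * Real.exp v ≤
      Real.exp (q * u + (1 - q) * v + (u - v) ^ 2 / 2) := by
  obtain ⟨h0, h1⟩ := hq
  have hJ : Real.exp (-(q * u + (1 - q) * v)) ≤ q * Real.exp (-u) + (1 - q) * Real.exp (-v) := by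
    have := convexOn_exp.2 (Set.mem_univ (-u)) (Set.mem_univ (-v)) h0 (sub_nonneg.2 h1) (by ring)
    simp only [smul_eq_mul] at this
    have e : q * -u + (1 - q) * -v = -(q * u + (1 - q) * v) := by ring
    rwa [e] at this
  have hpos : 0 ≤ q * Real.exp u + (1 - q) * Real.exp v :=
    add_nonneg (mul_nonneg h0 (Real.exp_pos _).le)
      (mul_nonneg (sub_nonneg.2 h1) (Real.exp_pos _).le)
  have hprod : (q * Real.exp u + (1 - q) * Real.exp v) *
      (q * Real.exp (-u) + (1 - q) * Real.exp (-v)) ≤ Real.cosh (u - v) := by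
    have e1 : Real.exp u * Real.exp (-u) = 1 := by rw [← Real.exp_add]; simp
    have e2 : Real.exp v * Real.exp (-v) = 1 := by rw [← Real.exp_add]; simp
    have e3 : Real.exp u * Real.exp (-v) + Real.exp v * Real.exp (-u) =
        2 * Real.cosh (u - v) := by
      rw [Real.cosh_eq, ← Real.exp_add, ← Real.exp_add]
      ring_nf
    have e4 := Real.one_le_cosh (u - v)
    have : (q * Real.exp u + (1 - q) * Real.exp v) *
        (q * Real.exp (-u) + (1 - q) * Real.exp (-v)) =
        q ^ 2 + (1 - q) ^ 2 + q * (1 - q) * (2 * Real.cosh (u - v)) := by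
      rw [← e3]
      linear_combination q ^ 2 * e1 + (1 - q) ^ 2 * e2
    rw [this]
    nlinarith [mul_nonneg h0 (sub_nonneg.2 h1), sq_nonneg (q - (1 - q))]
  rw [Real.exp_add, ← div_le_iff₀' (Real.exp_pos _), div_eq_mul_inv, ← Real.exp_neg]
  exact ((mul_le_mul_of_nonneg_left hJ hpos).trans hprod).trans (Real.cosh_le_exp_half_sq _)

theorem bernExp_fin_succ {N : ℕ} (q : Fin (N + 1) → ℝ) (F : (Fin (N + 1) → Bool) → ℝ) :
    bernExp q F =
      q 0 * bernExp (fun k => q k.succ) (fun x => F (Fin.cons true x)) +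
        (1 - q 0) * bernExp (fun k => q k.succ) (fun x => F (Fin.cons false x)) := by
  unfold bernExp
  rw [← (Fin.consEquiv fun _ : Fin (N + 1) => Bool).sum_comp, Fintype.sum_prod_type,
    Fintype.sum_bool, Finset.mul_sum, Finset.mul_sum]
  congr 1 <;> refine Finset.sum_congr rfl fun x _ => ?_ <;>
    simp [Fin.consEquiv, Fin.prod_univ_succ, bernWeight, mul_assoc]

/-- Induction on the number of bits: the bound for the other bits is applied with the first one
frozen. The two conditional means differ by at most `c 0`, and the two-point bound averages over the
first bit. -/
theorem bernExp_exp_le_fin {N : ℕ} (q : Fin N → ℝ) (hq : ∀ i, q i ∈ Set.Icc (0 : ℝ) 1)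
    (F : (Fin N → Bool) → ℝ) (c : Fin N → ℝ)
    (h : ∀ x k b, |F (Function.update x k b) - F x| ≤ c k) :
    bernExp q (fun x => Real.exp (F x)) ≤ Real.exp (bernExp q F + (∑ k, c k ^ 2) / 2) := by
  induction N with
  | zero => simp [bernExp]
  | succ N ih =>
    have hb : ∀ b, bernExp (fun k => q k.succ) (fun x => Real.exp (F (Fin.cons b x))) ≤
        Real.exp (bernExp (fun k => q k.succ) (fun x => F (Fin.cons b x)) +
          (∑ k : Fin N, c k.succ ^ 2) / 2) := by
      intro b
      refine ih _ (fun i => hq _) _ _ fun x k b' => ?_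
      have := h (Fin.cons b x) k.succ b'
      rwa [← Fin.cons_update] at this
    set u := bernExp (fun k => q k.succ) (fun x => F (Fin.cons true x)) with hu
    set v := bernExp (fun k => q k.succ) (fun x => F (Fin.cons false x)) with hv
    have huv : |u - v| ≤ c 0 := by
      have hle : ∀ b b' : Bool, bernExp (fun k => q k.succ) (fun x => F (Fin.cons b x)) ≤
          bernExp (fun k => q k.succ) (fun x => F (Fin.cons b' x)) + c 0 := by
        intro b b'
        rw [← bernExp_const (fun k : Fin N => q k.succ) (c 0), ← bernExp_add]
        refine bernExp_mono (fun i => hq _) fun x => ?_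
        have := h (Fin.cons b' x) 0 b
        rw [Fin.update_cons_zero] at this
        linarith [(abs_le.1 this).2]
      exact abs_le.2 ⟨by linarith [hle false true], by linarith [hle true false]⟩
    have hsq : (u - v) ^ 2 ≤ c 0 ^ 2 := by
      rw [← sq_abs]
      gcongr
    rw [bernExp_fin_succ, bernExp_fin_succ q F, ← hu, ← hv, Fin.sum_univ_succ]
    calc _ ≤ q 0 * Real.exp (u + (∑ k : Fin N, c k.succ ^ 2) / 2) +
          (1 - q 0) * Real.exp (v + (∑ k : Fin N, c k.succ ^ 2) / 2) :=
          add_le_add (mul_le_mul_of_nonneg_left (hb true) (hq 0).1)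
            (mul_le_mul_of_nonneg_left (hb false) (sub_nonneg.2 (hq 0).2))
      _ ≤ _ := two_point_exp_le (hq 0) _ _
      _ ≤ _ := by
          apply Real.exp_le_exp.2
          linarith [hsq, (by ring : (u + (∑ k : Fin N, c k.succ ^ 2) / 2 -
            (v + (∑ k : Fin N, c k.succ ^ 2) / 2)) ^ 2 = (u - v) ^ 2)]

/-- McDiarmid's bound on the exponential moment of a function with bounded differences. -/
theorem bernExp_exp_le (q : ι → ℝ) (hq : ∀ i, q i ∈ Set.Icc (0 : ℝ) 1)
    (F : (ι → Bool) → ℝ) (c : ι → ℝ)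
    (h : ∀ x k b, |F (Function.update x k b) - F x| ≤ c k) :
    bernExp q (fun x => Real.exp (F x)) ≤ Real.exp (bernExp q F + (∑ k, c k ^ 2) / 2) := by
  have e := (Fintype.equivFin ι).symm
  rw [bernExp_comp_equiv e, bernExp_comp_equiv e q F, ← e.sum_comp]
  refine bernExp_exp_le_fin _ (fun i => hq _) _ _ fun x k b => ?_
  have := h (fun i => x (e.symm i)) (e k) b
  convert this using 4
  funext i
  simp only [Function.update_apply, Equiv.symm_apply_eq]

/-- McDiarmid's inequality, with a free exponential parameter. -/
theorem bernProb_le_of_bddDiff (q : ι → ℝ) (hq : ∀ i, q i ∈ Set.Icc (0 : ℝ) 1)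
    (F : (ι → Bool) → ℝ) (c : ι → ℝ)
    (h : ∀ x k b, |F (Function.update x k b) - F x| ≤ c k) {s t V : ℝ} (hs : 0 ≤ s)
    (hV : ∑ k, c k ^ 2 ≤ V) :
    bernProb q {x | t ≤ F x - bernExp q F} ≤ Real.exp (-(s * t) + s ^ 2 * V / 2) := by
  have h1 := bernExp_exp_le q hq (fun x => s * F x + -(s * bernExp q F + s * t))
    (fun k => s * c k) (fun x k b => by
      rw [add_sub_add_right_eq_sub, ← mul_sub, abs_mul, abs_of_nonneg hs]
      exact mul_le_mul_of_nonneg_left (h x k b) hs)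
  refine (bernProb_le_of_exp hq fun x hx => ?_).trans (h1.trans (Real.exp_le_exp.2 ?_))
  · have : s * t ≤ s * (F x - bernExp q F) := mul_le_mul_of_nonneg_left hx hs
    linarith
  · rw [bernExp_add, bernExp_mul_left, bernExp_const]
    simp only [mul_pow, ← Finset.mul_sum]
    have := mul_le_mul_of_nonneg_left hV (sq_nonneg s)
    linarith

/-- Independence of the users: the rows of the array factor. -/
theorem bernExp_rows {n m : ℕ} (q : Fin n × Fin m → ℝ) (G : Fin n → (Fin m → Bool) → ℝ) :
    bernExp q (fun x => ∏ l, G l (fun i => x (l, i))) =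
      ∏ l, bernExp (fun i => q (l, i)) (G l) := by
  have h := Finset.prod_univ_sum (fun _ : Fin n => (Finset.univ : Finset (Fin m → Bool)))
    (fun l y => (∏ i, bernWeight (q (l, i)) (y i)) * G l y)
  rw [Fintype.piFinset_univ] at h
  unfold bernExp
  rw [h, ← (Equiv.curry (Fin n) (Fin m) Bool).symm.sum_comp]
  refine Finset.sum_congr rfl fun x _ => ?_
  rw [Finset.prod_mul_distrib, Fintype.prod_prod_type]
  rfl

theorem exp_le_of_mem_Icc {y s : ℝ} (hy : y ∈ Set.Icc (0 : ℝ) 1) (hs : |s| ≤ 1) :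
    Real.exp (s * y) ≤ 1 + (s + s ^ 2) * y := by
  have h1 : |s * y| ≤ 1 := by
    rw [abs_mul, abs_of_nonneg hy.1]
    exact mul_le_one₀ hs hy.1 hy.2
  have h2 := (abs_le.1 (Real.abs_exp_sub_one_sub_id_le h1)).2
  have h3 : (s * y) ^ 2 ≤ s ^ 2 * y := by
    rw [mul_pow]
    exact mul_le_mul_of_nonneg_left (by nlinarith [hy.1, hy.2]) (sq_nonneg s)
  linarith

theorem bernExp_exp_rows_le {n m : ℕ} (q : Fin n × Fin m → ℝ)
    (hq : ∀ i, q i ∈ Set.Icc (0 : ℝ) 1) (Y : Fin n → (Fin m → Bool) → ℝ)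
    (hY : ∀ l y, Y l y ∈ Set.Icc (0 : ℝ) 1) {s : ℝ} (hs : |s| ≤ 1) :
    bernExp q (fun x => Real.exp (s * ∑ l, Y l (fun i => x (l, i)))) ≤
      Real.exp ((s + s ^ 2) * ∑ l, bernExp (fun i => q (l, i)) (Y l)) := by
  simp only [Finset.mul_sum, Real.exp_sum]
  rw [bernExp_rows q (fun l y => Real.exp (s * Y l y))]
  refine Finset.prod_le_prod (fun l _ => bernExp_nonneg (fun i => hq _)
    fun y => (Real.exp_pos _).le) fun l _ => ?_
  calc _ ≤ bernExp (fun i => q (l, i)) (fun y => 1 + (s + s ^ 2) * Y l y) :=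
        bernExp_mono (fun i => hq _) fun y => exp_le_of_mem_Icc (hY l y) hs
    _ = (s + s ^ 2) * bernExp (fun i => q (l, i)) (Y l) + 1 := by
        rw [bernExp_add, bernExp_mul_left, bernExp_const, add_comm]
    _ ≤ _ := Real.add_one_le_exp _

/-- The two-sided multiplicative Chernoff bound for a sum of independent `[0, 1]`-valued functions
of the rows of `x`. -/
theorem bernProb_chernoff {n m : ℕ} (q : Fin n × Fin m → ℝ)
    (hq : ∀ i, q i ∈ Set.Icc (0 : ℝ) 1) (Y : Fin n → (Fin m → Bool) → ℝ)
    (hY : ∀ l y, Y l y ∈ Set.Icc (0 : ℝ) 1) {ε : ℝ} (hε0 : 0 ≤ ε) (hε : ε ≤ 2) {μ : ℝ}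
    (hμ : ∑ l, bernExp (fun i => q (l, i)) (Y l) = μ) :
    bernProb q {x | ¬ |∑ l, Y l (fun i => x (l, i)) - μ| ≤ ε * μ} ≤
      2 * Real.exp (-(ε ^ 2 * μ / 4)) := by
  have hs : |ε / 2| ≤ 1 := by rw [abs_of_nonneg (by linarith)]; linarith
  -- Used with `s = ε / 2` and `s = -(ε / 2)`, which minimize `s ^ 2 * μ - |s| * (ε * μ)` for `μ ≥
  -- 0`; the value is `-(ε ^ 2 * μ / 4)`. The restriction `ε ≤ 2` ensures `|s| ≤ 1`.
  have key : ∀ s, |s| ≤ 1 → ∀ S : Set (Fin n × Fin m → Bool),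
      (∀ x ∈ S, 0 ≤ s * (∑ l, Y l (fun i => x (l, i)) - μ) - |s| * (ε * μ)) →
      bernProb q S ≤ Real.exp (s ^ 2 * μ - |s| * (ε * μ)) := by
    intro s hs S hS
    refine (bernProb_le_of_exp hq hS).trans ?_
    have h1 := bernExp_exp_rows_le q hq Y hY hs
    have : ∀ x : Fin n × Fin m → Bool,
        Real.exp (s * (∑ l, Y l (fun i => x (l, i)) - μ) - |s| * (ε * μ)) =
          Real.exp (-(s * μ) - |s| * (ε * μ)) * Real.exp (s * ∑ l, Y l (fun i => x (l, i))) := by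
      intro x
      rw [← Real.exp_add]
      ring_nf
    simp only [this]
    rw [bernExp_mul_left]
    refine (mul_le_mul_of_nonneg_left h1 (Real.exp_pos _).le).trans (le_of_eq ?_)
    rw [hμ, ← Real.exp_add]
    ring_nf
  have hu := key (ε / 2) hs {x | ε * μ ≤ ∑ l, Y l (fun i => x (l, i)) - μ} (fun x hx => by
    rw [abs_of_nonneg (by linarith : 0 ≤ ε / 2), ← mul_sub]
    exact mul_nonneg (by linarith) (sub_nonneg.2 hx))
  have hl := key (-(ε / 2)) (by rwa [abs_neg])
    {x | ε * μ ≤ -(∑ l, Y l (fun i => x (l, i)) - μ)} (fun x hx => by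
      rw [abs_neg, abs_of_nonneg (by linarith : 0 ≤ ε / 2), neg_mul, ← mul_neg, ← mul_sub]
      exact mul_nonneg (by linarith) (sub_nonneg.2 hx))
  rw [abs_of_nonneg (by linarith : 0 ≤ ε / 2)] at hu
  rw [abs_neg, abs_of_nonneg (by linarith : 0 ≤ ε / 2)] at hl
  have hun := bernProb_iUnion_le hq (Finset.univ : Finset Bool) (fun b =>
    if b then {x : Fin n × Fin m → Bool | ε * μ ≤ ∑ l, Y l (fun i => x (l, i)) - μ}
    else {x | ε * μ ≤ -(∑ l, Y l (fun i => x (l, i)) - μ)})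
  rw [Fintype.sum_bool] at hun
  refine (bernProb_mono hq fun x hx => ?_).trans (hun.trans ?_)
  · simp only [Set.mem_ofPred_eq, not_le, lt_abs] at hx
    simp only [Set.mem_iUnion]
    rcases hx with hx | hx
    · exact ⟨true, Finset.mem_univ _, by simpa using hx.le⟩
    · exact ⟨false, Finset.mem_univ _, by simpa using hx.le⟩
  · simp only [if_true, Bool.false_eq_true, if_false]
    have e1 : (ε / 2) ^ 2 * μ - ε / 2 * (ε * μ) = -(ε ^ 2 * μ / 4) := by ring
    have e2 : (-(ε / 2)) ^ 2 * μ - ε / 2 * (ε * μ) = -(ε ^ 2 * μ / 4) := by ring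
    rw [e1] at hu
    rw [e2] at hl
    linarith

end FiniteProduct

/-! ### From the Rasch model to finite sums over bits -/

section Transfer

/-- The success probabilities of the Rasch model. -/
noncomputable def respProb {n m : ℕ} (θ : Fin n → ℝ) (β : Fin m → ℝ) (q : Fin n × Fin m) : ℝ :=
  1 / (1 + Real.exp (-(θ q.1 - β q.2)))

variable {n m : ℕ} {θ : Fin n → ℝ} {β : Fin m → ℝ}

theorem respProb_pos (q : Fin n × Fin m) : 0 < respProb θ β q := by
  unfold respProb
  positivity

theorem respProb_lt_one (q : Fin n × Fin m) : respProb θ β q < 1 := by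
  unfold respProb
  rw [div_lt_one (by positivity)]
  linarith [Real.exp_pos (-(θ q.1 - β q.2))]

theorem respProb_mem (q : Fin n × Fin m) : respProb θ β q ∈ Set.Icc (0 : ℝ) 1 :=
  ⟨(respProb_pos q).le, (respProb_lt_one q).le⟩

/-- Detailed balance for one user: both sides equal `exp (θ l + β i + β j)` divided by `(exp (θ l) +
exp (β i)) * (exp (θ l) + exp (β j))`. -/
theorem exp_mul_respProb_comm (l : Fin n) (i j : Fin m) :
    Real.exp (β i) * (respProb θ β (l, i) * (1 - respProb θ β (l, j))) =
      Real.exp (β j) * (respProb θ β (l, j) * (1 - respProb θ β (l, i))) := by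
  have e : ∀ i, Real.exp (-(θ l - β i)) = Real.exp (β i) / Real.exp (θ l) := by
    intro i
    rw [← Real.exp_sub]
    congr 1
    ring
  simp only [respProb, e]
  have h1 := Real.exp_pos (θ l)
  have h2 := Real.exp_pos (β i)
  have h3 := Real.exp_pos (β j)
  field_simp
  ring

variable {Ω : Type*} [MeasurableSpace Ω] {μ : Measure Ω} [IsProbabilityMeasure μ] {p : ℝ}
  {A X : Fin n → Fin m → Ω → Bool}

/-- The array of values of the bits `A l i` at a sample point. -/
def sample (A : Fin n → Fin m → Ω → Bool) (ω : Ω) (q : Fin n × Fin m) : Bool := A q.1 q.2 ω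

theorem measurable_sample (hA : ∀ l i, Measurable (A l i)) : Measurable (sample A) :=
  measurable_pi_lambda _ fun q => hA q.1 q.2

theorem real_preimage_singleton_bool {Y : Ω → Bool} (hY : Measurable Y) {r : ℝ}
    (hr : μ.real {ω | Y ω = true} = r) (b : Bool) : μ.real (Y ⁻¹' {b}) = bernWeight r b := by
  change μ.real (Y ⁻¹' {true}) = r at hr
  cases b
  · have : Y ⁻¹' {false} = (Y ⁻¹' {true})ᶜ := by
      ext ω
      simp
    rw [this, probReal_compl_eq_one_sub (hY (measurableSet_singleton true)), hr]
    simp [bernWeight]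
  · simpa [bernWeight] using hr

/-- Independence makes the joint law of all bits a product of Bernoulli weights. Letting the set of
responses depend on the pattern gives the Fubini form needed to argue with `A` fixed. -/
theorem IsModel.real_eq (h : IsModel μ p θ β A X)
    (S : (Fin n × Fin m → Bool) → Set (Fin n × Fin m → Bool)) :
    μ.real {ω | sample X ω ∈ S (sample A ω)} =
      bernExp (fun _ => p) (fun a => bernProb (respProb θ β) (S a)) := by
  classical
  set Y := Sum.elim (fun q : Fin n × Fin m => A q.1 q.2) (fun q : Fin n × Fin m => X q.1 q.2)
    with hY
  have hYm : ∀ s, Measurable (Y s) := by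
    rintro (q | q)
    exacts [h.measurable_A _ _, h.measurable_X _ _]
  set Z : Ω → (Fin n × Fin m) ⊕ (Fin n × Fin m) → Bool := fun ω s => Y s ω with hZ
  have hZm : Measurable Z := measurable_pi_lambda _ hYm
  have hpt : ∀ z, μ.real (Z ⁻¹' {z}) =
      (∏ q, bernWeight p (z (Sum.inl q))) * ∏ q, bernWeight (respProb θ β q) (z (Sum.inr q)) := by
    intro z
    have e : Z ⁻¹' {z} = ⋂ s ∈ Finset.univ, Y s ⁻¹' {z s} := by
      ext ω
      simp [hZ, funext_iff]
    rw [e, measureReal_def, h.indep.measure_inter_preimage_eq_mul Finset.univ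
      (fun s _ => measurableSet_singleton _), ENNReal.toReal_prod, Fintype.prod_sum_type]
    congr 1 <;> refine Finset.prod_congr rfl fun q _ => ?_
    · exact real_preimage_singleton_bool (h.measurable_A _ _) (h.prob_A _ _) _
    · exact real_preimage_singleton_bool (h.measurable_X _ _) (h.prob_X _ _) _
  set T : Set ((Fin n × Fin m) ⊕ (Fin n × Fin m) → Bool) :=
    {z | (fun q => z (Sum.inr q)) ∈ S (fun q => z (Sum.inl q))} with hT
  have hset : {ω | sample X ω ∈ S (sample A ω)} = Z ⁻¹' ↑(Finset.univ.filter (· ∈ T)) := by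
    ext ω
    simp only [Set.mem_ofPred_eq, Set.mem_preimage, Finset.coe_filter, Finset.mem_univ, true_and,
      hT]
    rfl
  rw [hset, ← sum_measureReal_preimage_singleton _ (fun z _ => hZm (measurableSet_singleton z)),
    Finset.sum_filter, ← (Equiv.sumArrowEquivProdArrow _ _ _).symm.sum_comp,
    Fintype.sum_prod_type]
  unfold bernProb bernExp
  refine Finset.sum_congr rfl fun a _ => ?_
  rw [Finset.mul_sum]
  refine Finset.sum_congr rfl fun x _ => ?_
  rw [hpt]
  by_cases hx : x ∈ S a
  · rw [if_pos (by exact hx), Set.indicator_of_mem hx]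
    simp [Equiv.sumArrowEquivProdArrow]
  · rw [if_neg (by exact hx), Set.indicator_of_notMem hx]
    simp

theorem IsModel.pairMean_eq (h : IsModel μ p θ β A X) (l : Fin n) {i j : Fin m} (hij : i ≠ j) :
    pairMean μ X l i j = respProb θ β (l, i) * (1 - respProb θ β (l, j)) := by
  have hb : ∀ i, ∫ ω, bit (X l i ω) ∂μ = respProb θ β (l, i) := by
    intro i
    have : (fun ω => bit (X l i ω)) = (X l i ⁻¹' {true}).indicator 1 := by
      funext ω
      by_cases hx : X l i ω = true <;> simp [bit, hx]
    rw [this, integral_indicator_one (h.measurable_X l i (measurableSet_singleton true))]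
    exact h.prob_X l i
  have hm : ∀ f : Bool → ℝ, Measurable f := fun f => measurable_of_finite f
  have hbd : ∀ i, Integrable (fun ω => bit (X l i ω)) μ := by
    intro i
    refine Integrable.of_bound ((hm bit).comp (h.measurable_X l i)).aestronglyMeasurable 1
      (Filter.Eventually.of_forall fun ω => ?_)
    cases X l i ω <;> simp [bit]
  have hind : IndepFun (X l i) (X l j) μ := by
    have := h.indep.indepFun (i := Sum.inr (l, i)) (j := Sum.inr (l, j)) (by simpa using hij)
    simpa using this
  have hind' := hind.comp (hm bit) (hm fun b => 1 - bit b)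
  have := hind'.integral_mul_eq_mul_integral
    ((hm bit).comp (h.measurable_X l i)).aestronglyMeasurable
    ((hm fun b => 1 - bit b).comp (h.measurable_X l j)).aestronglyMeasurable
  simp only [Pi.mul_apply, Function.comp_apply] at this
  rw [pairMean, this, integral_sub (integrable_const _) (hbd j), hb, hb]
  simp

end Transfer

/-! ### Concentration of the counts, the rates and the stationarity defect -/

section Concentration

theorem chainOf_row_sum {m : ℕ} (w : Fin m → Fin m → ℝ) (i : Fin m) :
    ∑ j, chainOf w i j = 1 := by
  rw [← Finset.add_sum_erase _ _ (Finset.mem_univ i)]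
  have : ∑ j ∈ Finset.univ.erase i, chainOf w i j = ∑ j ∈ Finset.univ.erase i, w i j :=
    Finset.sum_congr rfl fun j hj => by simp [chainOf, (Finset.ne_of_mem_erase hj).symm]
  rw [this]
  simp [chainOf]

theorem chainOf_apply_ne {m : ℕ} (w : Fin m → Fin m → ℝ) {i j : Fin m} (hij : i ≠ j) :
    chainOf w i j = w i j := by
  simp [chainOf, hij]

theorem chainOf_congr {m : ℕ} {w w' : Fin m → Fin m → ℝ} (h : ∀ i j, i ≠ j → w i j = w' i j) :
    chainOf w = chainOf w' := by
  ext i j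
  by_cases hij : i = j
  · subst hij
    simp only [chainOf, Matrix.of_apply, if_true]
    rw [Finset.sum_congr rfl fun k hk => h i k (Finset.ne_of_mem_erase hk).symm]
  · rw [chainOf_apply_ne _ hij, chainOf_apply_ne _ hij, h i j hij]

/-- Tested against `v`, the defect `π M - π` is linear in the off-diagonal rates: the diagonal
enters only through the row sums. -/
theorem sum_mul_vecMul_chainOf {m : ℕ} (w : Fin m → Fin m → ℝ) (π v : Fin m → ℝ) :
    ∑ i, v i * (π ᵥ* chainOf w) i =
      ∑ i, v i * π i + ∑ i, ∑ j, π i * (v j - v i) * w i j := by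
  have hmul : ∀ i, ∑ j, chainOf w i j * v j = v i + ∑ j, (v j - v i) * w i j := by
    intro i
    have h1 : ∑ j, chainOf w i j * v j = v i + ∑ j, chainOf w i j * (v j - v i) := by
      simp only [mul_sub, Finset.sum_sub_distrib, ← Finset.sum_mul, chainOf_row_sum]
      ring
    rw [h1]
    congr 1
    refine Finset.sum_congr rfl fun j _ => ?_
    by_cases hij : i = j
    · simp [hij]
    · rw [chainOf_apply_ne _ hij, mul_comm]
  have h2 : ∑ i, v i * (π ᵥ* chainOf w) i = ∑ i, π i * ∑ j, chainOf w i j * v j := by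
    simp only [Matrix.vecMul, dotProduct, Finset.mul_sum]
    rw [Finset.sum_comm]
    exact Finset.sum_congr rfl fun i _ => Finset.sum_congr rfl fun j _ => by ring
  rw [h2]
  simp only [hmul, mul_add, Finset.sum_add_distrib, Finset.mul_sum, mul_assoc]
  congr 1
  exact Finset.sum_congr rfl fun i _ => mul_comm _ _

theorem bit_mem (b : Bool) : bit b ∈ Set.Icc (0 : ℝ) 1 := by
  cases b <;> simp [bit]

variable {n m : ℕ}

/-- The number of users whose responses to both items are observed, for a sampling pattern `a`. -/
def patCount (a : Fin n × Fin m → Bool) (i j : Fin m) : ℝ :=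
  ∑ l, bit (a (l, i)) * bit (a (l, j))

/-- The off-diagonal entries of the empirical chain, for a sampling pattern `a` and responses `x`,
normalized by `D`. -/
noncomputable def empRate (D : ℝ) (a x : Fin n × Fin m → Bool) (i j : Fin m) : ℝ :=
  1 / D * ∑ l, bit (a (l, i)) * bit (a (l, j)) * (bit (x (l, i)) * (1 - bit (x (l, j))))

/-- The expectation of `empRate` over responses with success probabilities `q`. -/
noncomputable def meanRate (D : ℝ) (q : Fin n × Fin m → ℝ) (a : Fin n × Fin m → Bool)
    (i j : Fin m) : ℝ :=
  1 / D * ∑ l, bit (a (l, i)) * bit (a (l, j)) * (q (l, i) * (1 - q (l, j)))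

theorem bernExp_empRate (D : ℝ) (q : Fin n × Fin m → ℝ) (a : Fin n × Fin m → Bool)
    {i j : Fin m} (hij : i ≠ j) :
    bernExp q (fun x => empRate D a x i j) = meanRate D q a i j := by
  simp only [empRate, meanRate]
  rw [bernExp_mul_left, bernExp_sum]
  congr 1
  refine Finset.sum_congr rfl fun l _ => ?_
  rw [bernExp_mul_left, bernExp_pair q (i := (l, i)) (j := (l, j)) (by simpa using hij) bit
    (fun b => 1 - bit b)]
  simp [bit]

theorem abs_resp_update_sub_le (x : Fin n × Fin m → Bool) (k : Fin n × Fin m) (b : Bool)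
    (l : Fin n) (i j : Fin m) :
    |bit (Function.update x k b (l, i)) * (1 - bit (Function.update x k b (l, j))) -
        bit (x (l, i)) * (1 - bit (x (l, j)))| ≤
      if l = k.1 then (if i = k.2 then 1 else 0) + (if j = k.2 then 1 else 0) else 0 := by
  obtain ⟨l', k⟩ := k
  have hb : ∀ b₁ b₂ b₃ b₄ : Bool,
      |bit b₁ * (1 - bit b₂) - bit b₃ * (1 - bit b₄)| ≤ 1 := by
    intro b₁ b₂ b₃ b₄
    cases b₁ <;> cases b₂ <;> cases b₃ <;> cases b₄ <;> simp [bit]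
  by_cases hl : l = l'
  · subst hl
    by_cases hi : i = k
    · by_cases hj : j = k
      · simpa [hi, hj] using (hb _ _ _ _).trans (by norm_num)
      · simpa [hi, hj] using hb b (x (l, j)) (x (l, k)) (x (l, j))
    · by_cases hj : j = k
      · simpa [hi, hj] using hb (x (l, i)) b (x (l, i)) (x (l, k))
      · simp [hi, hj]
  · simp [hl]

/-- One response of user `l` to item `k` enters only the rates of the pairs `(k, j)` and `(j, k)`.
Each has a coefficient of size at most `2 K`, whence `4 K`. -/
theorem abs_linear_update_sub_le {D K : ℝ} (hD : 0 < D) (a x : Fin n × Fin m → Bool)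
    {π v : Fin m → ℝ} (hπ0 : ∀ i, 0 ≤ π i) (hπ : ∀ i, π i ≤ K) (hv : ∀ i, |v i| ≤ 1)
    (k : Fin n × Fin m) (b : Bool) :
    |∑ i, ∑ j, π i * (v j - v i) * empRate D a (Function.update x k b) i j -
        ∑ i, ∑ j, π i * (v j - v i) * empRate D a x i j| ≤
      4 * K / D * ∑ j ∈ Finset.univ.erase k.2, bit (a (k.1, k.2)) * bit (a (k.1, j)) := by
  obtain ⟨l, k⟩ := k
  set u : Fin m → Fin m → ℝ := fun i j => bit (a (l, i)) * bit (a (l, j)) with hu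
  have hK : 0 ≤ K := (hπ0 k).trans (hπ k)
  have hrate : ∀ i j, |empRate D a (Function.update x (l, k) b) i j - empRate D a x i j| ≤
      1 / D * (u i j * ((if i = k then 1 else 0) + (if j = k then 1 else 0))) := by
    intro i j
    unfold empRate
    rw [← mul_sub, abs_mul, abs_of_pos (by positivity : 0 < 1 / D), ← Finset.sum_sub_distrib]
    refine mul_le_mul_of_nonneg_left ?_ (by positivity)
    refine (Finset.abs_sum_le_sum_abs _ _).trans ?_
    have hsum : u i j * ((if i = k then 1 else 0) + (if j = k then 1 else 0)) =
        ∑ l', if l' = l then bit (a (l', i)) * bit (a (l', j)) *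
          ((if i = k then 1 else 0) + (if j = k then 1 else 0)) else 0 := by
      rw [Finset.sum_ite_eq' Finset.univ l, if_pos (Finset.mem_univ l)]
    rw [hsum]
    refine Finset.sum_le_sum fun l' _ => ?_
    rw [← mul_sub, abs_mul,
      abs_of_nonneg (mul_nonneg (bit_mem (a (l', i))).1 (bit_mem (a (l', j))).1)]
    refine (mul_le_mul_of_nonneg_left (abs_resp_update_sub_le x (l, k) b l' i j)
      (mul_nonneg (bit_mem _).1 (bit_mem _).1)).trans (le_of_eq ?_)
    split_ifs <;> simp
  have hcoef : ∀ i j, |π i * (v j - v i)| ≤ if i = j then 0 else 2 * K := by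
    intro i j
    split_ifs with hij
    · simp [hij]
    · rw [abs_mul, abs_of_nonneg (hπ0 i), mul_comm]
      refine mul_le_mul ?_ (hπ i) (hπ0 i) (by norm_num)
      linarith [abs_sub (v j) (v i), hv i, hv j]
  rw [← Finset.sum_sub_distrib]
  simp only [← Finset.sum_sub_distrib, ← mul_sub]
  calc _ ≤ ∑ i, ∑ j, (if i = j then 0 else 2 * K) *
        (1 / D * (u i j * ((if i = k then 1 else 0) + (if j = k then 1 else 0)))) := by
        refine (Finset.abs_sum_le_sum_abs _ _).trans (Finset.sum_le_sum fun i _ => ?_)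
        refine (Finset.abs_sum_le_sum_abs _ _).trans (Finset.sum_le_sum fun j _ => ?_)
        rw [abs_mul]
        refine mul_le_mul (hcoef i j) (hrate i j) (abs_nonneg _) ?_
        split_ifs <;> linarith
    _ = ∑ j, (if k = j then 0 else 2 * K) * (1 / D * u k j) +
        ∑ i, (if i = k then 0 else 2 * K) * (1 / D * u i k) := by
        simp only [mul_add, Finset.sum_add_distrib]
        congr 1
        · rw [Finset.sum_comm]
          simp
        · simp
    _ = _ := by
        rw [Finset.mul_sum, ← Finset.sum_add_distrib,
          ← Finset.add_sum_erase _ _ (Finset.mem_univ k)]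
        simp only [if_true, zero_mul, zero_add]
        refine Finset.sum_congr rfl fun j hj => ?_
        have hj := Finset.ne_of_mem_erase hj
        rw [if_neg hj, if_neg hj.symm]
        simp only [hu]
        ring

theorem sum_sq_bddDiff_le {D K N : ℝ} (hN : 0 < N) (hm : 0 < m) (hD : D = 3 * m * N / 2)
    (a : Fin n × Fin m → Bool) (ha : ∀ i j, i ≠ j → patCount a i j ≤ 3 * N / 2) :
    ∑ k : Fin n × Fin m, (4 * K / D *
        ∑ j ∈ Finset.univ.erase k.2, bit (a (k.1, k.2)) * bit (a (k.1, j))) ^ 2 ≤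
      11 * K ^ 2 * m / N := by
  have hm' : (0 : ℝ) < m := by exact_mod_cast hm
  have h0 : ∀ (l : Fin n) (i j : Fin m), bit (a (l, i)) * bit (a (l, j)) ∈ Set.Icc (0 : ℝ) 1 :=
    fun l i j => ⟨mul_nonneg (bit_mem _).1 (bit_mem _).1,
      mul_le_one₀ (bit_mem _).2 (bit_mem _).1 (bit_mem _).2⟩
  have hcard : ∀ k : Fin m, ((Finset.univ.erase k).card : ℝ) ≤ m := by
    intro k
    have := Finset.card_le_univ (Finset.univ.erase k)
    rw [Fintype.card_fin] at this
    exact_mod_cast this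
  -- One factor of the square is bounded by `m`; the other, summed over users, becomes a
  -- co-observation count of size at most `3 N / 2`.
  have hsq : ∀ k : Fin n × Fin m,
      (∑ j ∈ Finset.univ.erase k.2, bit (a (k.1, k.2)) * bit (a (k.1, j))) ^ 2 ≤
        m * ∑ j ∈ Finset.univ.erase k.2, bit (a (k.1, k.2)) * bit (a (k.1, j)) := by
    intro k
    rw [sq]
    refine mul_le_mul_of_nonneg_right ?_ (Finset.sum_nonneg fun j _ => (h0 _ _ _).1)
    refine le_trans ?_ (hcard k.2)
    have := Finset.sum_le_card_nsmul (Finset.univ.erase k.2)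
      (fun j => bit (a (k.1, k.2)) * bit (a (k.1, j))) 1 (fun j _ => (h0 _ _ _).2)
    simpa using this
  have htot : ∑ k : Fin n × Fin m,
      ∑ j ∈ Finset.univ.erase k.2, bit (a (k.1, k.2)) * bit (a (k.1, j)) ≤
        m * (m * (3 * N / 2)) := by
    rw [Fintype.sum_prod_type, Finset.sum_comm]
    have : ∀ k : Fin m, ∑ l, ∑ j ∈ Finset.univ.erase k, bit (a (l, k)) * bit (a (l, j)) ≤
        m * (3 * N / 2) := by
      intro k
      rw [Finset.sum_comm]
      calc _ ≤ ∑ j ∈ Finset.univ.erase k, 3 * N / 2 :=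
            Finset.sum_le_sum fun j hj => ha k j (Finset.ne_of_mem_erase hj).symm
        _ ≤ _ := by
            rw [Finset.sum_const, nsmul_eq_mul]
            exact mul_le_mul_of_nonneg_right (hcard k) (by positivity)
    refine (Finset.sum_le_sum fun k _ => this k).trans (le_of_eq ?_)
    simp
  simp only [mul_pow (4 * K / D)]
  rw [← Finset.mul_sum]
  calc _ ≤ (4 * K / D) ^ 2 * (m * (m * (m * (3 * N / 2)))) := by
        refine mul_le_mul_of_nonneg_left ?_ (sq_nonneg _)
        refine (Finset.sum_le_sum fun k _ => hsq k).trans ?_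
        rw [← Finset.mul_sum]
        exact mul_le_mul_of_nonneg_left htot hm'.le
    _ = 32 / 3 * (K ^ 2 * m / N) := by
        rw [hD]
        field_simp
        ring
    _ ≤ _ := by
        have : 0 ≤ K ^ 2 * m / N := by positivity
        have e : 11 * K ^ 2 * m / N = 11 * (K ^ 2 * m / N) := by ring
        rw [e]
        linarith

/-- Concentration of `π M - π` in the `ℓ¹` norm, where `M` is the empirical chain and `π` is
stationary for its mean. -/
theorem bernProb_sum_abs_vecMul_sub {D K N R : ℝ} (hN : 0 < N) (hm : 0 < m)
    (hD : D = 3 * m * N / 2) {q : Fin n × Fin m → ℝ} (hq : ∀ i, q i ∈ Set.Icc (0 : ℝ) 1)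
    (a : Fin n × Fin m → Bool) (ha : ∀ i j, i ≠ j → patCount a i j ≤ 3 * N / 2)
    {π : Fin m → ℝ} (hK : 0 < K) (hπ0 : ∀ i, 0 ≤ π i) (hπ : ∀ i, π i ≤ K)
    (hst : π ᵥ* chainOf (meanRate D q a) = π) (hR : 0 ≤ R) :
    bernProb q {x | ¬ ∑ i, |(π ᵥ* chainOf (empRate D a x)) i - π i| ≤ 44 * K * m * √R / √N} ≤
      2 ^ m * Real.exp (-(88 * (m * R))) := by
  have hm' : (0 : ℝ) < m := by exact_mod_cast hm
  have hD0 : 0 < D := by rw [hD]; positivity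
  set t := 44 * K * m * √R / √N with ht
  set V := 11 * K ^ 2 * m / N with hV
  -- The minimizer of `-(s t) + s ^ 2 V / 2`; the minimum is `-t ^ 2 / (2 V)`, and `44 ^ 2 / 22 =
  -- 88`.
  set s := t / V with hs
  have hN2 : √N ^ 2 = N := Real.sq_sqrt hN.le
  have hR2 : √R ^ 2 = R := Real.sq_sqrt hR
  have hsN : 0 < √N := Real.sqrt_pos.2 hN
  have hs0 : 0 ≤ s := by positivity
  have hexp : -(s * t) + s ^ 2 * V / 2 = -(88 * (m * R)) := by
    have hVne : V ≠ 0 := by positivity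
    have h1 : -(s * t) + s ^ 2 * V / 2 = -(t ^ 2 / (2 * V)) := by
      rw [hs]
      field_simp
      ring
    rw [h1, ht, hV, div_pow, mul_pow, mul_pow, mul_pow, hN2, hR2]
    field_simp
    ring
  let sg : (Fin m → Bool) → Fin m → ℝ := fun σ i => if σ i then 1 else -1
  have hsg : ∀ σ i, |sg σ i| ≤ 1 := by
    intro σ i
    simp only [sg]
    split_ifs <;> simp
  let F : (Fin m → Bool) → (Fin n × Fin m → Bool) → ℝ := fun σ x =>
    ∑ i, ∑ j, π i * (sg σ j - sg σ i) * empRate D a x i j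
  -- Stationarity of `π` for the mean chain is what centres the statistic.
  have hmean : ∀ σ, bernExp q (F σ) = 0 := by
    intro σ
    have h1 := sum_mul_vecMul_chainOf (meanRate D q a) π (sg σ)
    rw [hst] at h1
    have h2 : bernExp q (F σ) = ∑ i, ∑ j, π i * (sg σ j - sg σ i) * meanRate D q a i j := by
      simp only [F]
      rw [bernExp_sum]
      refine Finset.sum_congr rfl fun i _ => ?_
      rw [bernExp_sum]
      refine Finset.sum_congr rfl fun j _ => ?_
      rw [bernExp_mul_left]
      by_cases hij : i = j
      · simp [hij]
      · rw [bernExp_empRate D q a hij]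
    linarith
  have hlin : ∀ σ x, ∑ i, sg σ i * ((π ᵥ* chainOf (empRate D a x)) i - π i) = F σ x := by
    intro σ x
    have h1 := sum_mul_vecMul_chainOf (empRate D a x) π (sg σ)
    simp only [mul_sub, Finset.sum_sub_distrib, F] at h1 ⊢
    linarith
  have htail : ∀ σ, bernProb q {x | t ≤ F σ x - bernExp q (F σ)} ≤
      Real.exp (-(88 * (m * R))) := by
    intro σ
    rw [← hexp]
    exact bernProb_le_of_bddDiff q hq (F σ) _
      (fun x k b => abs_linear_update_sub_le hD0 a x hπ0 hπ (hsg σ) k b) hs0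
      (sum_sq_bddDiff_le hN hm hD a ha)
  have hcov : {x | ¬ ∑ i, |(π ᵥ* chainOf (empRate D a x)) i - π i| ≤ t} ⊆
      ⋃ σ ∈ (Finset.univ : Finset (Fin m → Bool)), {x | t ≤ F σ x - bernExp q (F σ)} := by
    intro x hx
    simp only [Set.mem_ofPred_eq, not_le] at hx
    simp only [Set.mem_iUnion]
    -- The sign pattern of the defect attains its `ℓ¹` norm.
    refine ⟨fun i => decide (0 ≤ (π ᵥ* chainOf (empRate D a x)) i - π i), Finset.mem_univ _, ?_⟩
    simp only [Set.mem_ofPred_eq]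
    rw [hmean, sub_zero, ← hlin]
    refine hx.le.trans (le_of_eq (Finset.sum_congr rfl fun i _ => ?_))
    simp only [sg, decide_eq_true_eq]
    split_ifs with h
    · rw [abs_of_nonneg h, one_mul]
    · rw [abs_of_neg (not_le.1 h), neg_one_mul]
  refine (bernProb_mono hq hcov).trans ((bernProb_iUnion_le hq _ _).trans ?_)
  refine (Finset.sum_le_sum fun σ _ => htail σ).trans (le_of_eq ?_)
  simp

/-- Simultaneous concentration of the co-observation counts. -/
theorem bernProb_patCount {p N : ℝ} (hp : p ∈ Set.Icc (0 : ℝ) 1) (hN : N = n * p ^ 2) :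
    bernProb (fun _ : Fin n × Fin m => p)
        {a | ¬ ∀ i j, i ≠ j → N / 2 ≤ patCount a i j ∧ patCount a i j ≤ 3 * N / 2} ≤
      m ^ 2 * (2 * Real.exp (-(N / 16))) := by
  have htail : ∀ r ∈ (Finset.univ : Finset (Fin m × Fin m)),
      bernProb (fun _ : Fin n × Fin m => p)
        {a | r.1 ≠ r.2 ∧ ¬ |patCount a r.1 r.2 - N| ≤ 1 / 2 * N} ≤
          2 * Real.exp (-(N / 16)) := by
    rintro ⟨i, j⟩ -
    by_cases hij : i = j
    · have : {a : Fin n × Fin m → Bool | i ≠ j ∧ ¬ |patCount a i j - N| ≤ 1 / 2 * N} = ∅ := by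
        ext a
        simp [hij]
      simp only [this, bernProb, Set.indicator_empty]
      have h0 := bernExp_const (fun _ : Fin n × Fin m => p) 0
      rw [show bernExp (fun _ : Fin n × Fin m => p) (fun _ => 0) = 0 from h0]
      positivity
    · have h := bernProb_chernoff (fun _ : Fin n × Fin m => p) (fun _ => hp)
        (fun _ y => bit (y i) * bit (y j))
        (fun _ y => ⟨mul_nonneg (bit_mem _).1 (bit_mem _).1,
          mul_le_one₀ (bit_mem _).2 (bit_mem _).1 (bit_mem _).2⟩)
        (ε := 1 / 2) (by norm_num) (by norm_num) (μ := N) (by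
          simp only [bernExp_pair (fun _ : Fin m => p) hij bit bit]
          simp [bit, hN, sq])
      have e : (1 / 2 : ℝ) ^ 2 * N / 4 = N / 16 := by ring
      rw [e] at h
      exact (bernProb_mono (fun _ => hp) fun a ha => ha.2).trans h
  refine (bernProb_mono (fun _ => hp) ?_).trans
    ((bernProb_iUnion_le (fun _ => hp) Finset.univ _).trans
      ((Finset.sum_le_sum htail).trans (le_of_eq ?_)))
  · intro a ha
    simp only [Set.mem_ofPred_eq, not_forall] at ha
    obtain ⟨i, j, hij, ha⟩ := ha
    simp only [Set.mem_iUnion]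
    refine ⟨(i, j), Finset.mem_univ _, hij, fun h => ha ?_⟩
    have := abs_le.1 h
    exact ⟨by linarith [this.1], by linarith [this.2]⟩
  · simp [sq]

/-- Simultaneous relative concentration of the off-diagonal entries of the empirical chain. -/
theorem bernProb_empRate {D N g ε : ℝ} (hD : 0 < D) {q : Fin n × Fin m → ℝ}
    (hq : ∀ i, q i ∈ Set.Icc (0 : ℝ) 1) (a : Fin n × Fin m → Bool)
    (ha : ∀ i j, i ≠ j → N / 2 ≤ patCount a i j) (hg0 : 0 ≤ g)
    (hg : ∀ l i j, i ≠ j → g ≤ q (l, i) * (1 - q (l, j))) (hε0 : 0 ≤ ε) (hε : ε ≤ 2) :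
    bernProb q {x | ¬ ∀ i j, i ≠ j →
        |empRate D a x i j - meanRate D q a i j| ≤ ε * meanRate D q a i j} ≤
      m ^ 2 * (2 * Real.exp (-(ε ^ 2 * (g * N) / 8))) := by
  have htail : ∀ r ∈ (Finset.univ : Finset (Fin m × Fin m)),
      bernProb q {x | r.1 ≠ r.2 ∧ ¬ |empRate D a x r.1 r.2 - meanRate D q a r.1 r.2| ≤
        ε * meanRate D q a r.1 r.2} ≤ 2 * Real.exp (-(ε ^ 2 * (g * N) / 8)) := by
    rintro ⟨i, j⟩ -
    by_cases hij : i = j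
    · have : {x : Fin n × Fin m → Bool | i ≠ j ∧
          ¬ |empRate D a x i j - meanRate D q a i j| ≤ ε * meanRate D q a i j} = ∅ := by
        ext x
        simp [hij]
      simp only [this, bernProb, Set.indicator_empty]
      rw [show bernExp q (fun _ => 0) = 0 from bernExp_const q 0]
      positivity
    · have h := bernProb_chernoff q hq
        (fun l y => bit (a (l, i)) * bit (a (l, j)) * (bit (y i) * (1 - bit (y j))))
        (fun l y => by
          cases a (l, i) <;> cases a (l, j) <;> cases y i <;> cases y j <;> simp [bit])
        hε0 hε (μ := ∑ l, bit (a (l, i)) * bit (a (l, j)) * (q (l, i) * (1 - q (l, j)))) (by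
          refine Finset.sum_congr rfl fun l _ => ?_
          rw [bernExp_mul_left, bernExp_pair (fun i => q (l, i)) hij bit (fun b => 1 - bit b)]
          simp [bit])
      refine (bernProb_mono hq fun x hx => ?_).trans (h.trans ?_)
      · refine fun hx' => hx.2 ?_
        simp only [empRate, meanRate]
        rw [← mul_sub, abs_mul, abs_of_pos (by positivity : 0 < 1 / D), mul_left_comm]
        exact mul_le_mul_of_nonneg_left hx' (by positivity)
      -- The lower bound on the counts bounds the mean of the sum below, turning the Chernoff
      -- exponent into `ε ^ 2 * (g * N) / 8`.
      · have hμ : g * (N / 2) ≤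
            ∑ l, bit (a (l, i)) * bit (a (l, j)) * (q (l, i) * (1 - q (l, j))) := by
          refine (mul_le_mul_of_nonneg_left (ha i j hij) hg0).trans ?_
          rw [patCount, mul_comm, Finset.sum_mul]
          exact Finset.sum_le_sum fun l _ => mul_le_mul_of_nonneg_left (hg l i j hij)
            (mul_nonneg (bit_mem _).1 (bit_mem _).1)
        have := mul_le_mul_of_nonneg_left hμ (sq_nonneg ε)
        gcongr 2 * Real.exp ?_
        linarith
  refine (bernProb_mono hq ?_).trans
    ((bernProb_iUnion_le hq Finset.univ _).trans
      ((Finset.sum_le_sum htail).trans (le_of_eq ?_)))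
  · intro x hx
    simp only [Set.mem_ofPred_eq, not_forall] at hx
    obtain ⟨i, j, hij, hx⟩ := hx
    simp only [Set.mem_iUnion]
    exact ⟨(i, j), Finset.mem_univ _, hij, hx⟩
  · simp [sq]

end Concentration

/-! ### Model parameters and reversibility of the true chain -/

section Parameters

variable {n m : ℕ} {θ : Fin n → ℝ} {β : Fin m → ℝ} {Ω : Type*} [MeasurableSpace Ω]
  {μ : Measure Ω} [IsProbabilityMeasure μ] {p : ℝ} {A X : Fin n → Fin m → Ω → Bool}

theorem kappa_nonneg (β : Fin m → ℝ) : 0 ≤ kappa β :=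
  Real.iSup_nonneg fun _ => abs_nonneg _

theorem piStar_pos (hm : 0 < m) (β : Fin m → ℝ) (i : Fin m) : 0 < piStar β i :=
  div_pos (Real.exp_pos _)
    (Finset.sum_pos (fun _ _ => Real.exp_pos _) ⟨⟨0, hm⟩, Finset.mem_univ _⟩)

theorem sum_piStar (hm : 0 < m) (β : Fin m → ℝ) : ∑ i, piStar β i = 1 := by
  unfold piStar
  rw [← Finset.sum_div]
  exact div_self (Finset.sum_pos (fun _ _ => Real.exp_pos _) ⟨⟨0, hm⟩, Finset.mem_univ _⟩).ne'

theorem IsModel.gamma_le (h : IsModel μ p θ β A X) (l : Fin n) {i j : Fin m} (hij : i ≠ j) :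
    gamma μ X ≤ respProb θ β (l, i) * (1 - respProb θ β (l, j)) := by
  rw [← h.pairMean_eq l hij]
  exact ciInf_le (Set.finite_range _).bddBelow
    (⟨(l, i, j), hij⟩ : {q : Fin n × Fin m × Fin m // q.2.1 ≠ q.2.2})

theorem IsModel.gamma_pos (h : IsModel μ p θ β A X) (hn : 0 < n) (hm : 2 ≤ m) :
    0 < gamma μ X := by
  have : Nonempty {q : Fin n × Fin m × Fin m // q.2.1 ≠ q.2.2} :=
    ⟨⟨(⟨0, hn⟩, ⟨0, by omega⟩, ⟨1, by omega⟩), by simp⟩⟩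
  obtain ⟨⟨⟨l, i, j⟩, hij⟩, hq⟩ := exists_eq_ciInf_of_finite
    (f := fun q : {q : Fin n × Fin m × Fin m // q.2.1 ≠ q.2.2} =>
      pairMean μ X q.1.1 q.1.2.1 q.1.2.2)
  unfold gamma
  rw [← hq]
  simp only
  rw [h.pairMean_eq l hij]
  exact mul_pos (respProb_pos _) (sub_pos.2 (respProb_lt_one _))

theorem IsModel.gamma_le_one (h : IsModel μ p θ β A X) (hn : 0 < n) (hm : 2 ≤ m) :
    gamma μ X ≤ 1 := by
  refine (h.gamma_le ⟨0, hn⟩ (i := ⟨0, by omega⟩) (j := ⟨1, by omega⟩) (by simp)).trans ?_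
  exact mul_le_one₀ (respProb_lt_one _).le (sub_pos.2 (respProb_lt_one _)).le
    (by linarith [respProb_pos (θ := θ) (β := β) (⟨0, hn⟩, ⟨1, by omega⟩)])

theorem IsModel.trueChain_eq (h : IsModel μ p θ β A X) (ω : Ω) :
    trueChain μ p A X ω = chainOf (meanRate (normd n m p) (respProb θ β) (sample A ω)) := by
  refine chainOf_congr fun i j hij => ?_
  simp only [meanRate]
  congr 1
  exact Finset.sum_congr rfl fun l _ => by rw [h.pairMean_eq l hij]; rfl

theorem vecMul_chainOf_of_reversible {w : Fin m → Fin m → ℝ} {π : Fin m → ℝ}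
    (h : ∀ i j, π i * w i j = π j * w j i) : π ᵥ* chainOf w = π := by
  have hs : ∀ i j, π i * chainOf w i j = π j * chainOf w j i := by
    intro i j
    by_cases hij : i = j
    · rw [hij]
    · rw [chainOf_apply_ne _ hij, chainOf_apply_ne _ (Ne.symm hij), h]
  funext i
  simp only [Matrix.vecMul, dotProduct]
  rw [Finset.sum_congr rfl fun j _ => hs j i, ← Finset.mul_sum, chainOf_row_sum, mul_one]

theorem piStar_vecMul_meanRate (D : ℝ) (a : Fin n × Fin m → Bool) :
    piStar β ᵥ* chainOf (meanRate D (respProb θ β) a) = piStar β := by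
  refine vecMul_chainOf_of_reversible fun i j => ?_
  simp only [meanRate, mul_left_comm _ (1 / D), Finset.mul_sum]
  refine Finset.sum_congr rfl fun l _ => ?_
  have := exp_mul_respProb_comm (θ := θ) (β := β) l i j
  simp only [piStar]
  linear_combination 1 / D * (bit (a (l, i)) * bit (a (l, j))) / (∑ k, Real.exp (β k)) * this

end Parameters

/-! ### Deterministic consequences of the good events -/

section Deterministic

variable {n m : ℕ} {N D g : ℝ}

theorem le_diag_chainOf (hm : 0 < m) {w : Fin m → Fin m → ℝ}
    (hw : ∀ i j, i ≠ j → w i j ≤ 1 / m) (i : Fin m) : 1 / m ≤ chainOf w i i := by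
  have hm' : (0 : ℝ) < m := by exact_mod_cast hm
  have h1 : ∑ k ∈ Finset.univ.erase i, w i k ≤ ((m : ℝ) - 1) * (1 / m) := by
    have := Finset.sum_le_card_nsmul (Finset.univ.erase i) (w i) (1 / m)
      fun j hj => hw i j (Finset.ne_of_mem_erase hj).symm
    rw [Finset.card_erase_of_mem (Finset.mem_univ i), Finset.card_univ, Fintype.card_fin,
      nsmul_eq_mul, Nat.cast_sub hm] at this
    simpa using this
  have h2 : ((m : ℝ) - 1) * (1 / m) = 1 - 1 / m := by
    field_simp
  simp only [chainOf, Matrix.of_apply, if_true]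
  linarith

/-- The normalization `D` is chosen for this: with counts at most `3 N / 2`, off-diagonal entries
are at most `1 / m`, which leaves at least `1 / m` on the diagonal. -/
theorem rate_le (hm : 0 < m) (hN : 0 < N) (hD : D = 3 * m * N / 2) {a : Fin n × Fin m → Bool}
    {i j : Fin m} (ha : patCount a i j ≤ 3 * N / 2) {z : Fin n → ℝ} (hz : ∀ l, z l ≤ 1) :
    1 / D * ∑ l, bit (a (l, i)) * bit (a (l, j)) * z l ≤ 1 / m := by
  have hm' : (0 : ℝ) < m := by exact_mod_cast hm
  have h1 : ∑ l, bit (a (l, i)) * bit (a (l, j)) * z l ≤ 3 * N / 2 := by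
    refine le_trans (Finset.sum_le_sum fun l _ => ?_) ha
    exact mul_le_of_le_one_right (mul_nonneg (bit_mem _).1 (bit_mem _).1) (hz l)
  have hD0 : 0 < D := by rw [hD]; positivity
  calc _ ≤ 1 / D * (3 * N / 2) := mul_le_mul_of_nonneg_left h1 (by positivity)
    _ = 1 / m := by
      rw [hD]
      field_simp

theorem le_meanRate (hm : 0 < m) (hN : 0 < N) (hD : D = 3 * m * N / 2) (hg : 0 < g)
    {q : Fin n × Fin m → ℝ} {a : Fin n × Fin m → Bool} {i j : Fin m}
    (ha : N / 2 ≤ patCount a i j) (hq : ∀ l, g ≤ q (l, i) * (1 - q (l, j))) :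
    g / (3 * m) ≤ meanRate D q a i j := by
  have hm' : (0 : ℝ) < m := by exact_mod_cast hm
  have hD0 : 0 < D := by rw [hD]; positivity
  have h1 : N / 2 * g ≤ ∑ l, bit (a (l, i)) * bit (a (l, j)) * (q (l, i) * (1 - q (l, j))) := by
    refine (mul_le_mul_of_nonneg_right ha hg.le).trans ?_
    rw [patCount, Finset.sum_mul]
    exact Finset.sum_le_sum fun l _ => mul_le_mul_of_nonneg_left (hq l)
      (mul_nonneg (bit_mem _).1 (bit_mem _).1)
  calc g / (3 * m) = 1 / D * (N / 2 * g) := by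
        rw [hD]
        field_simp
    _ ≤ _ := mul_le_mul_of_nonneg_left h1 (by positivity)

/-- Existence, uniqueness and the entrywise perturbation bound on the good events. -/
theorem stationary_of_good {t ε : ℝ} (hm : 2 ≤ m) (hN : 0 < N) (hD : D = 3 * m * N / 2)
    (hg : 0 < g) (hg1 : g ≤ 1) (hε : ε ≤ 1 / 2) {θ : Fin n → ℝ} {β : Fin m → ℝ}
    (hq : ∀ l i j, i ≠ j → g ≤ respProb θ β (l, i) * (1 - respProb θ β (l, j)))
    {a x : Fin n × Fin m → Bool}
    (ha : ∀ i j, i ≠ j → N / 2 ≤ patCount a i j ∧ patCount a i j ≤ 3 * N / 2)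
    (hx : ∀ i j, i ≠ j → |empRate D a x i j - meanRate D (respProb θ β) a i j| ≤
      ε * meanRate D (respProb θ β) a i j)
    (ht : ∑ i, |(piStar β ᵥ* chainOf (empRate D a x)) i - piStar β i| ≤ t) :
    IsTheStationary (chainOf (meanRate D (respProb θ β) a)) (piStar β) ∧
      ∃ π, IsTheStationary (chainOf (empRate D a x)) π ∧
        ∀ i, |π i - piStar β i| ≤ 4 * ε * piStar β i + 72 * t / (g ^ 2 * m) := by
  have hm0 : 0 < m := by omega
  have hm' : (0 : ℝ) < m := by exact_mod_cast hm0
  have hNg : ∀ i j, i ≠ j → g / (3 * m) ≤ meanRate D (respProb θ β) a i j :=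
    fun i j hij => le_meanRate hm0 hN hD hg (ha i j hij).1 fun l => hq l i j hij
  have hMlow : ∀ i j, i ≠ j → g / (6 * m) ≤ empRate D a x i j := by
    intro i j hij
    have h1 := abs_le.1 (hx i j hij)
    have h2 := hNg i j hij
    have h3 : 0 ≤ meanRate D (respProb θ β) a i j := le_trans (by positivity) h2
    have h4 : g / (6 * m) = g / (3 * m) / 2 := by field_simp; ring
    nlinarith
  have hNm : ∀ i j, i ≠ j → meanRate D (respProb θ β) a i j ≤ 1 / m := fun i j hij =>
    rate_le hm0 hN hD (ha i j hij).2 fun l => mul_le_one₀ (respProb_lt_one _).le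
      (sub_pos.2 (respProb_lt_one _)).le (by linarith [respProb_pos (θ := θ) (β := β) (l, j)])
  have hMm : ∀ i j, i ≠ j → empRate D a x i j ≤ 1 / m := fun i j hij =>
    rate_le hm0 hN hD (ha i j hij).2 fun l => mul_le_one₀ (bit_mem _).2
      (sub_nonneg.2 (bit_mem _).2) (by linarith [(bit_mem (x (l, j))).1])
  have hge : ∀ w : Fin m → Fin m → ℝ, (∀ i j, i ≠ j → g / (6 * m) ≤ w i j) →
      (∀ i j, i ≠ j → w i j ≤ 1 / m) → ∀ i j, g / (6 * m) ≤ chainOf w i j := by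
    intro w h1 h2 i j
    by_cases hij : i = j
    · subst hij
      refine le_trans ?_ (le_diag_chainOf hm0 h2 i)
      rw [div_le_div_iff₀ (by positivity) (by positivity)]
      nlinarith
    · rw [chainOf_apply_ne _ hij]
      exact h1 i j hij
  have hmc : (0 : ℝ) < m * (g / (6 * m)) := by positivity
  have hM := hge _ hMlow hMm
  have hMs := hge (meanRate D (respProb θ β) a) (fun i j hij =>
    le_trans (div_le_div_of_nonneg_left hg.le (by positivity) (by linarith)) (hNg i j hij)) hNm
  have hst : IsStationary (chainOf (meanRate D (respProb θ β) a)) (piStar β) :=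
    ⟨fun i => (piStar_pos hm0 β i).le, sum_piStar hm0 β, piStar_vecMul_meanRate D a⟩
  obtain ⟨π, hπ⟩ := exists_isStationary hm0
    (fun i j => le_trans (by positivity) (hM i j)) (chainOf_row_sum (empRate D a x))
  refine ⟨⟨hst, fun π' h' => hst.eq_of_le hmc hMs (chainOf_row_sum _) h'⟩, π,
    ⟨hπ, fun π' h' => hπ.eq_of_le hmc hM (chainOf_row_sum _) h'⟩, ?_⟩
  refine hπ.abs_sub_le hm hg hg1 hε (chainOf_row_sum _) (chainOf_row_sum _) ?_ ?_ ?_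
    (le_diag_chainOf hm0 hMm) hst ht
  · intro i j hij
    simpa only [chainOf_apply_ne _ hij] using hx i j hij
  · intro i j hij
    simpa only [chainOf_apply_ne _ hij] using hNg i j hij
  · intro i j hij
    simpa only [chainOf_apply_ne _ hij] using hMm i j hij

/-- The perturbation bound has factors `3 / g` and `6 / g`, each dominated by its counterpart in
`errFactor`, since `g > 0` and `exp (2 κ) ≥ 1`. The constant `176` comes from `72 * 44 = 3 * 6 *
176`. -/
theorem error_le_errFactor {p κ C₁ K : ℝ} (hg : 0 < g) (hg1 : g ≤ 1) (hκ : 0 ≤ κ) (hC : 0 ≤ C₁)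
    (hm : 0 < m) (hK : 0 ≤ K) :
    4 * (C₁ * √(logMax n m p) / (√g * √(np2 n p))) * K +
        72 * (44 * K * m * √(max (Real.log (np2 n p) / m) 1) / √(np2 n p)) / (g ^ 2 * m) ≤
      errFactor n m p g κ C₁ 176 * K := by
  have hm' : (0 : ℝ) < m := by exact_mod_cast hm
  unfold errFactor
  set r := √(max (Real.log (np2 n p) / m) 1) / √(np2 n p) with hr
  set ε := C₁ * √(logMax n m p) / (√g * √(np2 n p)) with hε
  have hr0 : 0 ≤ r := by positivity
  have hε0 : 0 ≤ ε := by positivity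
  have hE1 : 1 ≤ Real.exp (2 * κ) := Real.one_le_exp (by positivity)
  set E := Real.exp (2 * κ) with hE
  have hx0 : 0 ≤ g / (12 * E) := by positivity
  have hx1 : g / (12 * E) ≤ 1 / 2 := by
    rw [div_le_div_iff₀ (by positivity) (by norm_num)]
    linarith
  have e1 : 2 * C₁ / √g * (√(logMax n m p) / √(np2 n p)) = 2 * ε := by
    rw [hε]
    ring
  have e2 : 176 * √(max (Real.log (np2 n p) / m) 1) / √(np2 n p) = 176 * r := by
    rw [hr]
    ring
  have e3 : 72 * (44 * K * m * √(max (Real.log (np2 n p) / m) 1) / √(np2 n p)) / (g ^ 2 * m) =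
      3 / g * (6 / g * (176 * r)) * K := by
    rw [hr]
    field_simp
    ring
  rw [e1, e2, e3]
  have h1 : 3 / g ≤ 1 / (g / 3 * (1 - g / (12 * E))) := by
    rw [div_le_div_iff₀ hg (mul_pos (by positivity) (by linarith))]
    nlinarith
  have h2 : 6 / g ≤ (1 + g / (12 * E)) / (g / (6 * E)) := by
    have : (1 + g / (12 * E)) / (g / (6 * E)) = (1 + g / (12 * E)) * E * (6 / g) := by
      field_simp
    rw [this]
    refine le_mul_of_one_le_left (by positivity) ?_
    nlinarith
  have h3 : 4 * ε ≤ 3 / g * (2 * ε) := by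
    rw [div_mul_eq_mul_div, le_div_iff₀ hg]
    nlinarith
  calc 4 * ε * K + 3 / g * (6 / g * (176 * r)) * K
      ≤ 3 / g * (2 * ε) * K + 3 / g * (6 / g * (176 * r)) * K := by gcongr
    _ = 3 / g * (2 * ε + 6 / g * (176 * r)) * K := by ring
    _ ≤ _ := by
        have h4 := le_trans (by positivity : 0 ≤ 3 / g) h1
        gcongr

end Deterministic

/-! ### Probability of the good events and conclusion -/

section Main

/-- With `B = max (log N) m` the exponent is `-88 B`; the prefactor is at most `exp (m + 1)` with `m
+ 1 ≤ 2 B`, so `exp (-40 B)` remains to spare. -/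
theorem two_mul_two_pow_mul_exp_le {m : ℕ} (hm : 0 < m) {N : ℝ} (hN : 0 < N) :
    2 * (2 ^ m * Real.exp (-(88 * (m * max (Real.log N / m) 1)))) ≤
      min (Real.exp (-40 * (m : ℝ))) (N ^ (-40 : ℤ)) := by
  have hm' : (1 : ℝ) ≤ m := by exact_mod_cast hm
  have hmax : m * max (Real.log N / m) 1 = max (Real.log N) m := by
    rw [mul_max_of_nonneg _ _ (by positivity), mul_div_cancel₀ _ (by positivity), mul_one]
  rw [hmax]
  have h2 : (2 : ℝ) ≤ Real.exp 1 := by linarith [Real.add_one_le_exp 1]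
  have h3 : 2 * (2 : ℝ) ^ m ≤ Real.exp (m + 1) := by
    calc 2 * (2 : ℝ) ^ m ≤ Real.exp 1 * Real.exp 1 ^ m := by gcongr
      _ = Real.exp (m + 1) := by rw [← Real.exp_nat_mul, ← Real.exp_add]; ring_nf
  have hle := le_max_left (Real.log N) (m : ℝ)
  have hri := le_max_right (Real.log N) (m : ℝ)
  set B := max (Real.log N) (m : ℝ)
  have h4 : 2 * (2 ^ m * Real.exp (-(88 * B))) ≤ Real.exp (-40 * B) := by
    rw [← mul_assoc]
    refine (mul_le_mul_of_nonneg_right h3 (Real.exp_pos _).le).trans ?_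
    rw [← Real.exp_add]
    exact Real.exp_le_exp.2 (by linarith)
  refine le_min (h4.trans (Real.exp_le_exp.2 (by linarith))) (h4.trans ?_)
  have h5 : N ^ (-40 : ℤ) = Real.exp (-40 * Real.log N) := by
    have e : -40 * Real.log N = -(((40 : ℕ) : ℝ) * Real.log N) := by norm_num
    rw [e, Real.exp_neg, Real.exp_nat_mul, Real.exp_log hN]
    rfl
  rw [h5]
  exact Real.exp_le_exp.2 (by linarith)

theorem sq_mul_exp_le {m : ℕ} (hm : 2 ≤ m) {z L : ℝ} (hL : Real.log m ≤ L) (hz : 30 * L ≤ z) :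
    (m : ℝ) ^ 2 * (2 * Real.exp (-z)) ≤ 1 / 4 := by
  have hm' : (2 : ℝ) ≤ m := by exact_mod_cast hm
  have hl0 : 0 ≤ Real.log m := Real.log_nonneg (by linarith)
  have h1 : Real.exp (-z) ≤ ((m : ℝ) ^ 5)⁻¹ := by
    rw [← Real.exp_log (by positivity : (0 : ℝ) < (m : ℝ) ^ 5), ← Real.exp_neg, Real.log_pow]
    refine Real.exp_le_exp.2 ?_
    push_cast
    linarith
  have h2 : (2 : ℝ) ^ 3 ≤ (m : ℝ) ^ 3 := by gcongr
  calc (m : ℝ) ^ 2 * (2 * Real.exp (-z)) ≤ (m : ℝ) ^ 2 * (2 * ((m : ℝ) ^ 5)⁻¹) := by gcongr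
    _ = 2 / (m : ℝ) ^ 3 := by field_simp
    _ ≤ 2 / 2 ^ 3 := by gcongr
    _ = 1 / 4 := by norm_num

/-- Subadditivity is enough here, so `t` need not be measurable. -/
theorem one_sub_le_cond_real {Ω : Type*} [MeasurableSpace Ω] {μ : Measure Ω}
    [IsProbabilityMeasure μ] {s t : Set Ω} (hs : MeasurableSet s) (hs2 : 1 / 2 ≤ μ.real s)
    {δ : ℝ} (h : 2 * μ.real (s ∩ tᶜ) ≤ δ) : 1 - δ ≤ (μ[|s]).real t := by
  have hs0 : μ s ≠ 0 := by
    intro h0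
    rw [measureReal_def, h0] at hs2
    norm_num at hs2
  have := cond_isProbabilityMeasure hs0
  have h1 : 1 ≤ (μ[|s]).real t + (μ[|s]).real tᶜ := by
    have := measureReal_union_le (μ := μ[|s]) t tᶜ
    rwa [Set.union_compl_self, probReal_univ] at this
  have h2 : (μ[|s]).real tᶜ ≤ δ := by
    rw [measureReal_def, cond_apply hs, ENNReal.toReal_mul, ENNReal.toReal_inv]
    change (μ.real s)⁻¹ * μ.real (s ∩ tᶜ) ≤ δ
    rw [inv_mul_le_iff₀ (by linarith)]
    nlinarith [measureReal_nonneg (μ := μ) (s := s ∩ tᶜ)]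
  linarith

end Main

section Main

variable {n m : ℕ} {θ : Fin n → ℝ} {β : Fin m → ℝ} {Ω : Type*} [MeasurableSpace Ω]
  {μ : Measure Ω} [IsProbabilityMeasure μ] {p : ℝ} {A X : Fin n → Fin m → Ω → Bool}

theorem IsModel.mem_eventE_iff (h : IsModel μ p θ β A X) (C₁ : ℝ) (ω : Ω) :
    ω ∈ eventE μ p A X C₁ ↔ ∀ i j, i ≠ j →
      |empRate (normd n m p) (sample A ω) (sample X ω) i j -
        meanRate (normd n m p) (respProb θ β) (sample A ω) i j| ≤
      C₁ * √(logMax n m p) / (√(gamma μ X) * √(np2 n p)) *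
        meanRate (normd n m p) (respProb θ β) (sample A ω) i j := by
  refine forall_congr' fun i => forall_congr' fun j => forall_congr' fun hij => ?_
  have e : empChain p A X ω i j = empRate (normd n m p) (sample A ω) (sample X ω) i j :=
    chainOf_apply_ne _ hij
  rw [h.trueChain_eq, e, chainOf_apply_ne _ hij]

theorem measurableSet_good (h : IsModel μ p θ β A X) (C₁ : ℝ) :
    MeasurableSet (condA p A ∩ eventE μ p A X C₁) := by
  set T : Set ((Fin n × Fin m → Bool) × (Fin n × Fin m → Bool)) :=
    {z | (∀ i j, i ≠ j → np2 n p / 2 ≤ patCount z.1 i j ∧ patCount z.1 i j ≤ 3 * np2 n p / 2) ∧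
      ∀ i j, i ≠ j → |empRate (normd n m p) z.1 z.2 i j -
        meanRate (normd n m p) (respProb θ β) z.1 i j| ≤
      C₁ * √(logMax n m p) / (√(gamma μ X) * √(np2 n p)) *
        meanRate (normd n m p) (respProb θ β) z.1 i j} with hT
  have e : condA p A ∩ eventE μ p A X C₁ = (fun ω => (sample A ω, sample X ω)) ⁻¹' T := by
    ext ω
    exact and_congr Iff.rfl (h.mem_eventE_iff C₁ ω)
  rw [e]
  exact ((measurable_sample h.measurable_A).prodMk (measurable_sample h.measurable_X))
    (Set.toFinite T).measurableSet

/-- A bound that holds for every fixed pattern in `G` survives averaging over the pattern. -/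
theorem IsModel.real_le (h : IsModel μ p θ β A X) (hp : p ∈ Set.Icc (0 : ℝ) 1)
    (G : Set (Fin n × Fin m → Bool)) (S : (Fin n × Fin m → Bool) → Set (Fin n × Fin m → Bool))
    {δ : ℝ} (hδ : 0 ≤ δ) (hS : ∀ a ∈ G, bernProb (respProb θ β) (S a) ≤ δ) :
    μ.real {ω | sample A ω ∈ G ∧ sample X ω ∈ S (sample A ω)} ≤ δ := by
  refine (h.real_eq fun a => {x | a ∈ G ∧ x ∈ S a}).trans_le ?_
  rw [← bernExp_const (fun _ : Fin n × Fin m => p) δ]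
  refine bernExp_mono (fun _ => hp) fun a => ?_
  by_cases ha : a ∈ G
  · exact (bernProb_mono respProb_mem fun x hx => hx.2).trans (hS a ha)
  · have : {x : Fin n × Fin m → Bool | a ∈ G ∧ x ∈ S a} = ∅ := by
      ext x
      simp [ha]
    simp only [this, bernProb, Set.indicator_empty]
    exact (bernExp_const (respProb θ β) 0).trans_le hδ

theorem IsModel.real_sample_A (h : IsModel μ p θ β A X) (G : Set (Fin n × Fin m → Bool)) :
    μ.real {ω | sample A ω ∈ G} = bernProb (fun _ => p) G := by
  have e := h.real_eq fun a => {_x | a ∈ G}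
  refine e.trans ?_
  unfold bernProb
  congr 1
  funext a
  by_cases ha : a ∈ G
  · have e : ({_x | a ∈ G} : Set (Fin n × Fin m → Bool)).indicator
        (1 : (Fin n × Fin m → Bool) → ℝ) = fun _ => 1 :=
      funext fun x => Set.indicator_of_mem (by exact ha) _
    rw [e, bernExp_const, Set.indicator_of_mem ha, Pi.one_apply]
  · have e : ({_x | a ∈ G} : Set (Fin n × Fin m → Bool)).indicator
        (1 : (Fin n × Fin m → Bool) → ℝ) = fun _ => 0 :=
      funext fun x => Set.indicator_of_notMem (by exact ha) _
    rw [e, bernExp_const, Set.indicator_of_notMem ha]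

end Main

end Rasch

theorem mainTheorem2 (C₁ : ℝ) (hC₁ : √240 ≤ C₁) :
    ∃ C₂ C₃ : ℝ, 0 < C₂ ∧ 0 < C₃ ∧
      ∀ {Ω : Type*} [MeasurableSpace Ω] (μ : Measure Ω) [IsProbabilityMeasure μ]
        (n m : ℕ) (_ : 2 ≤ m) (p : ℝ) (_ : 0 < p) (_ : p ≤ 1)
        (θ : Fin n → ℝ) (β : Fin m → ℝ) (A X : Fin n → Fin m → Ω → Bool)
        (_ : Rasch.IsModel μ p θ β A X)
        (_ : Rasch.np2 n p >
          max (C₁ ^ 2 / Rasch.gamma μ X * Rasch.logMax n m p)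
            (Real.exp (4 * Rasch.kappa β) * C₂ / Rasch.gamma μ X ^ 3 * Rasch.logMax n m p)),
        1 - min (Real.exp (-40 * (m : ℝ))) (Rasch.np2 n p ^ (-40 : ℤ)) ≤
          (μ[|Rasch.condA p A ∩ Rasch.eventE μ p A X C₁]).real
            {ω | Rasch.IsTheStationary (Rasch.trueChain μ p A X ω) (Rasch.piStar β) ∧
              ∃ π : Fin m → ℝ, Rasch.IsTheStationary (Rasch.empChain p A X ω) π ∧
                ‖π - Rasch.piStar β‖ ≤
                  Rasch.errFactor n m p (Rasch.gamma μ X) (Rasch.kappa β) C₁ C₃ *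
                    ‖Rasch.piStar β‖} := by
  have hC240 : 240 ≤ C₁ ^ 2 := by
    have := pow_le_pow_left₀ (Real.sqrt_nonneg 240) hC₁ 2
    rwa [Real.sq_sqrt (by norm_num)] at this
  have hC0 : 0 ≤ C₁ := (Real.sqrt_nonneg _).trans hC₁
  -- `C₂ = 4 C₁ ^ 2` yields `g N ≥ 4 C₁ ^ 2 L`, which is exactly `ε ≤ 1 / 2`.
  refine ⟨4 * C₁ ^ 2, 176, by positivity, by norm_num, ?_⟩
  intro Ω _ μ _ n m hm p hp0 hp1 θ β A X h hnp
  have hp : p ∈ Set.Icc (0 : ℝ) 1 := ⟨hp0.le, hp1⟩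
  have hm0 : 0 < m := by omega
  have hm2 : (2 : ℝ) ≤ m := by exact_mod_cast hm
  have hLm : Real.log m ≤ Rasch.logMax n m p := le_max_right _ _
  have hL0 : 0 < Rasch.logMax n m p := (Real.log_pos (by linarith)).trans_le hLm
  have hn : 0 < n := by
    rcases Nat.eq_zero_or_pos n with rfl | hn
    -- Without users `γ` is an infimum over an empty type, hence `0`; as division by `0` gives `0`,
    -- the sample size hypothesis reads `0 > 0`.
    · have hg : Rasch.gamma μ X = 0 := Real.iInf_of_isEmpty _
      simp [hg, Rasch.np2] at hnp
    · exact hn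
  have hg := h.gamma_pos hn hm
  have hg1 := h.gamma_le_one hn hm
  set g := Rasch.gamma μ X with hgdef
  have hκ := Rasch.kappa_nonneg β
  set N := Rasch.np2 n p with hNdef
  set L := Rasch.logMax n m p with hLdef
  have hN : 0 < N := by
    have : (0 : ℝ) < n := by exact_mod_cast hn
    exact mul_pos this (pow_pos hp0 2)
  have hgN : 4 * C₁ ^ 2 * L ≤ g * N := by
    have h1 : Real.exp (4 * Rasch.kappa β) * (4 * C₁ ^ 2) / g ^ 3 * L < N :=
      (le_max_right _ _).trans_lt hnp
    have h2 : 1 ≤ Real.exp (4 * Rasch.kappa β) := Real.one_le_exp (by positivity)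
    have h3 : 4 * C₁ ^ 2 * L / g ≤ Real.exp (4 * Rasch.kappa β) * (4 * C₁ ^ 2) / g ^ 3 * L := by
      rw [div_mul_eq_mul_div]
      refine div_le_div₀ (by positivity) ?_ (by positivity) ?_
      · rw [mul_assoc (Real.exp _)]
        exact le_mul_of_one_le_left (by positivity) h2
      · exact pow_le_of_le_one hg.le hg1 (by norm_num)
    have h4 := h3.trans h1.le
    rw [div_le_iff₀ hg] at h4
    linarith
  set ε := C₁ * √L / (√g * √N) with hε
  have hε0 : 0 ≤ ε := by positivity
  have hεsq : ε ^ 2 * (g * N) = C₁ ^ 2 * L := by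
    rw [hε, div_pow, mul_pow, mul_pow, Real.sq_sqrt hL0.le, Real.sq_sqrt hg.le,
      Real.sq_sqrt hN.le]
    field_simp
  have hεhalf : ε ≤ 1 / 2 := by
    have : 0 < g * N := by positivity
    refine (sq_le_sq₀ hε0 (by norm_num)).1 (le_of_mul_le_mul_right ?_ this)
    linarith
  have hN480 : 30 * L ≤ N / 16 := by nlinarith
  -- `C₁ ^ 2 / 8 ≥ 30` is where `C₁ ≥ √240` enters.
  have hε30 : 30 * L ≤ ε ^ 2 * (g * N) / 8 := by
    rw [hεsq]
    nlinarith
  have hD0 : 0 < Rasch.normd n m p := by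
    unfold Rasch.normd
    positivity
  have hcA : μ.real (Rasch.condA p A)ᶜ ≤ 1 / 4 := by
    have e := h.real_sample_A {a | ¬ ∀ i j, i ≠ j →
      N / 2 ≤ Rasch.patCount a i j ∧ Rasch.patCount a i j ≤ 3 * N / 2}
    exact (e.trans_le (Rasch.bernProb_patCount hp hNdef)).trans (Rasch.sq_mul_exp_le hm hLm hN480)
  have hcE : μ.real (Rasch.condA p A ∩ (Rasch.eventE μ p A X C₁)ᶜ) ≤ 1 / 4 := by
    refine le_trans (measureReal_mono fun ω hω => ?_) (h.real_le hp {a | ∀ i j, i ≠ j →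
      N / 2 ≤ Rasch.patCount a i j ∧ Rasch.patCount a i j ≤ 3 * N / 2} (fun a => {x |
        ¬ ∀ i j, i ≠ j → |Rasch.empRate (Rasch.normd n m p) a x i j -
          Rasch.meanRate (Rasch.normd n m p) (Rasch.respProb θ β) a i j| ≤
          ε * Rasch.meanRate (Rasch.normd n m p) (Rasch.respProb θ β) a i j})
        (by norm_num) fun a ha => ?_)
    · exact ⟨hω.1, fun hx => hω.2 ((h.mem_eventE_iff C₁ ω).2 hx)⟩
    · exact (Rasch.bernProb_empRate hD0 Rasch.respProb_mem a (fun i j hij => (ha i j hij).1) hg.le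
        (fun l i j hij => h.gamma_le l hij) hε0 (by linarith)).trans
        (Rasch.sq_mul_exp_le hm hLm hε30)
  have hgood : 1 / 2 ≤ μ.real (Rasch.condA p A ∩ Rasch.eventE μ p A X C₁) := by
    have h1 : (1 : ℝ) ≤ μ.real (Rasch.condA p A ∩ Rasch.eventE μ p A X C₁) +
        (μ.real (Rasch.condA p A)ᶜ + μ.real (Rasch.condA p A ∩ (Rasch.eventE μ p A X C₁)ᶜ)) := by
      rw [← probReal_univ (μ := μ)]
      refine le_trans (measureReal_mono ?_) ((measureReal_union_le _ _).trans
        (add_le_add_right (measureReal_union_le _ _) _))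
      intro ω _
      by_cases h1 : ω ∈ Rasch.condA p A
      · by_cases h2 : ω ∈ Rasch.eventE μ p A X C₁
        · exact Or.inl ⟨h1, h2⟩
        · exact Or.inr (Or.inr ⟨h1, h2⟩)
      · exact Or.inr (Or.inl h1)
    linarith
  refine Rasch.one_sub_le_cond_real (Rasch.measurableSet_good h C₁) hgood ?_
  refine le_trans ?_ (Rasch.two_mul_two_pow_mul_exp_le hm0 hN)
  refine mul_le_mul_of_nonneg_left ?_ (by norm_num)
  set K := ‖Rasch.piStar β‖ with hK
  set t := 44 * K * m * √(max (Real.log N / m) 1) / √N with ht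
  have hpi : ∀ i, Rasch.piStar β i ≤ K := fun i =>
    (le_abs_self _).trans (norm_le_pi_norm (Rasch.piStar β) i)
  have hK0 : 0 < K := (Rasch.piStar_pos hm0 β ⟨0, hm0⟩).trans_le (hpi _)
  refine le_trans (measureReal_mono fun ω hω => ?_) (h.real_le hp {a | ∀ i j, i ≠ j →
    N / 2 ≤ Rasch.patCount a i j ∧ Rasch.patCount a i j ≤ 3 * N / 2} (fun a => {x |
      ¬ ∑ i, |(Rasch.piStar β ᵥ* Rasch.chainOf (Rasch.empRate (Rasch.normd n m p) a x)) i -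
        Rasch.piStar β i| ≤ t}) (by positivity) fun a ha =>
      Rasch.bernProb_sum_abs_vecMul_sub hN hm0 rfl Rasch.respProb_mem a
        (fun i j hij => (ha i j hij).2) hK0 (fun i => (Rasch.piStar_pos hm0 β i).le) hpi
        (Rasch.piStar_vecMul_meanRate _ a) (zero_le_one.trans (le_max_right _ _)))
  refine ⟨hω.1.1, fun hx => hω.2 ?_⟩
  obtain ⟨hst, π, hπ, hb⟩ := Rasch.stationary_of_good hm hN rfl hg hg1 hεhalf
    (fun l i j hij => h.gamma_le l hij) (a := Rasch.sample A ω) hω.1.1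
    ((h.mem_eventE_iff C₁ ω).1 hω.1.2) hx
  refine ⟨by rwa [h.trueChain_eq], π, hπ, ?_⟩
  refine le_trans ?_ (Rasch.error_le_errFactor hg hg1 hκ hC0 hm0 hK0.le)
  refine (pi_norm_le_iff_of_nonneg (by positivity)).2 fun i => (hb i).trans ?_
  have := mul_le_mul_of_nonneg_left (hpi i) (by positivity : 0 ≤ 4 * ε)
  exact add_le_add this le_rfl
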